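/- Let $d\ge 1$ and let $\Omega\subset\mathbb{R}^d$ be a bounded region (bounded, open, connected) with piecewise $C^1$ boundary. This means that $\partial\Omega$ has finite $(d-1)$-dimensional Hausdorff measure and that, outside a subset of $\partial\Omega$ of $(d-1)$-dimensional Hausdorff measure zero, every boundary point $p$ is regular: near $p$ one has $\Omega=\{\rho<0\}$ for a $C^1$ function $\rho$ with $\rho(p)=0$ and $\nabla\rho(p)\ne 0$. At a regular point let $\mathbf{n}=\nabla\rho/|\nabla\rho|$ be the unit outward normal, and let $dS$ be $(d-1)$-dimensional surface measure on $\partial\Omega$ (for $d=1$, counting measure). Let $f,g:\mathbb{R}^d\to\mathbb{R}$ be $C^\infty$ functions such that $g(\mathbf{x})\ne 0$ and $\nabla g(\mathbf{x})\ne 0$ for all $\mathbf{x}\in\overline\Omega$. No condition on resonance points (boundary points at which $\nabla g$ is orthogonal to $\partial\Omega$) is needed. Let $\nu\in\mathbb{C}$ and let $J_\nu$ be the Bessel function of the first kind of order $\nu$, where complex powers take their principal values. Put $$\sigma_0=f,\qquad \sigma_k=g^{\nu+k}\,\nabla\cdot\left[\frac{\nabla g}{|\nabla g|^2\,g^{\nu+k}}\,\sigma_{k-1}\right]\quad(k\ge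 1).$$ Then, as $\omega\to\infty$, $$\int_\Omega f(\mathbf{x})\,J_\nu(\omega g(\mathbf{x}))\,dV\;\sim\;-\sum_{k=1}^\infty\frac{1}{(-\omega)^k}\int_{\partial\Omega}\frac{\nabla g(\mathbf{x})\cdot\mathbf{n}}{|\nabla g(\mathbf{x})|^2}\,\sigma_{k-1}(\mathbf{x})\,J_{\nu+k}(\omega g(\mathbf{x}))\,dS,$$ that is, all these integrals converge absolutely for $\omega>0$, and for every integer $s\ge 0$, $$\int_\Omega f\,J_\nu(\omega g)\,dV=-\sum_{k=1}^{s}\frac{1}{(-\omega)^k}\int_{\partial\Omega}\frac{\nabla g\cdot\mathbf{n}}{|\nabla g|^2}\,\sigma_{k-1}\,J_{\nu+k}(\omega g)\,dS+O\!\left(\omega^{-s-\frac32}\right),\qquad \omega\to\infty.$$ -/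

import Mathlib

open MeasureTheory Filter Topology Asymptotics
open scoped Gradient Nat

noncomputable section

/-- The Bessel function of the first kind `J_ν(z)`, of complex order `ν`, for `z ≠ 0`, by its
power series with the principal branch of `z ^ ν`. Where `ν + m + 1` is a pole of `Γ`, Mathlib has
`Γ = 0`, so that term of the series is `0`, as it should be. -/
def besselJ (ν z : ℂ) : ℂ :=
  (z / 2) ^ ν *
    ∑' m : ℕ, (-1) ^ m / ((m ! : ℂ) * Complex.Gamma (ν + m + 1)) * (z / 2) ^ (2 * m)

/-- `v` is the unit outward normal to `∂Ω` at the boundary point `p`: near `p` the set `Ω` is a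
sublevel set `{ρ < 0}` of a `C¹` function `ρ` with `ρ p = 0` and `∇ρ p ≠ 0`,
and `v = ∇ρ p / ‖∇ρ p‖`. -/
def IsUnitOutwardNormal {d : ℕ} (Ω : Set (EuclideanSpace ℝ (Fin d)))
    (p v : EuclideanSpace ℝ (Fin d)) : Prop :=
  ∃ ρ : EuclideanSpace ℝ (Fin d) → ℝ, ContDiffAt ℝ 1 ρ p ∧ ρ p = 0 ∧ ∇ ρ p ≠ 0 ∧
    (∀ᶠ x in 𝓝 p, x ∈ Ω ↔ ρ x < 0) ∧ v = ‖∇ ρ p‖⁻¹ • ∇ ρ p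

/-- The unit outward normal at `p` does not depend on the defining function. -/
theorem IsUnitOutwardNormal.unique {d : ℕ} {Ω : Set (EuclideanSpace ℝ (Fin d))}
    {p v w : EuclideanSpace ℝ (Fin d)} (hv : IsUnitOutwardNormal Ω p v)
    (hw : IsUnitOutwardNormal Ω p w) : v = w := by
  obtain ⟨ρ, hρ, hρ0, hρg, hρΩ, rfl⟩ := hv
  obtain ⟨τ, hτ, hτ0, hτg, hτΩ, rfl⟩ := hw
  set v := ‖∇ ρ p‖⁻¹ • ∇ ρ p with hvdef
  set w := ‖∇ τ p‖⁻¹ • ∇ τ p with hwdef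
  have hρn : 0 < ‖∇ ρ p‖ := norm_pos_iff.2 hρg
  have hτn : 0 < ‖∇ τ p‖ := norm_pos_iff.2 hτg
  have hv1 : ‖v‖ = 1 := by
    rw [hvdef, norm_smul, norm_inv, norm_norm, inv_mul_cancel₀ hρn.ne']
  have hw1 : ‖w‖ = 1 := by
    rw [hwdef, norm_smul, norm_inv, norm_norm, inv_mul_cancel₀ hτn.ne']
  have hρv : ∇ ρ p = ‖∇ ρ p‖ • v := by
    rw [hvdef, smul_smul, mul_inv_cancel₀ hρn.ne', one_smul]
  have hτw : ∇ τ p = ‖∇ τ p‖ • w := by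
    rw [hwdef, smul_smul, mul_inv_cancel₀ hτn.ne', one_smul]
  by_contra hne
  have hlt : inner ℝ v w < 1 := inner_lt_one_iff_real_of_norm_eq_one hv1 hw1 |>.2 hne
  -- along the direction `w - v` the function `ρ` decreases and `τ` increases
  have hline : HasDerivAt (fun t : ℝ => p + t • (w - v)) (w - v) 0 := by
    simpa using ((hasDerivAt_id (0 : ℝ)).smul_const (w - v)).const_add p
  have key : ∀ θ : EuclideanSpace ℝ (Fin d) → ℝ, ContDiffAt ℝ 1 θ p →
      HasDerivAt (fun t : ℝ => θ (p + t • (w - v))) (inner ℝ (∇ θ p) (w - v)) 0 := by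
    intro θ hθ
    have h1 : HasFDerivAt θ (InnerProductSpace.toDual ℝ _ (∇ θ p)) (p + (0 : ℝ) • (w - v)) := by
      simpa using (hθ.differentiableAt (by norm_num)).hasGradientAt.hasFDerivAt
    have h2 := h1.comp_hasDerivAt (0 : ℝ) hline
    rwa [InnerProductSpace.toDual_apply_apply] at h2
  have hdρ : inner ℝ (∇ ρ p) (w - v) < 0 := by
    rw [hρv, inner_smul_left, inner_sub_right, real_inner_self_eq_norm_sq, hv1]
    simp only [conj_trivial]
    nlinarith
  have hdτ : 0 < inner ℝ (∇ τ p) (w - v) := by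
    rw [hτw, inner_smul_left, inner_sub_right, real_inner_self_eq_norm_sq, hw1,
      real_inner_comm]
    simp only [conj_trivial]
    nlinarith
  have hcont : Tendsto (fun t : ℝ => p + t • (w - v)) (𝓝[>] 0) (𝓝 p) := by
    have := hline.continuousAt.tendsto
    simp only [zero_smul, add_zero] at this
    exact this.mono_left nhdsWithin_le_nhds
  have e1 : ∀ᶠ t : ℝ in 𝓝[>] 0, ρ (p + t • (w - v)) < 0 := by
    have := (hasDerivAt_iff_tendsto_slope.1 (key ρ hρ)).mono_left
      (nhdsWithin_mono 0 (fun t (ht : 0 < t) => ht.ne'))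
    filter_upwards [this.eventually_lt_const hdρ, self_mem_nhdsWithin] with t ht (ht0 : 0 < t)
    simp only [slope_def_field, zero_smul, add_zero, hρ0, sub_zero] at ht
    by_contra h
    exact absurd ht (not_lt.2 (div_nonneg (not_lt.1 h) ht0.le))
  have e2 : ∀ᶠ t : ℝ in 𝓝[>] 0, 0 < τ (p + t • (w - v)) := by
    have := (hasDerivAt_iff_tendsto_slope.1 (key τ hτ)).mono_left
      (nhdsWithin_mono 0 (fun t (ht : 0 < t) => ht.ne'))
    filter_upwards [this.eventually_const_lt hdτ, self_mem_nhdsWithin] with t ht (ht0 : 0 < t)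
    simp only [slope_def_field, zero_smul, add_zero, hτ0, sub_zero] at ht
    by_contra h
    exact absurd ht (not_lt.2 (div_nonpos_of_nonpos_of_nonneg (not_lt.1 h) ht0.le))
  obtain ⟨t, h1, h2, h3, h4⟩ :=
    (e1.and (e2.and ((hcont.eventually hρΩ).and (hcont.eventually hτΩ)))).exists
  exact absurd (h4.1 (h3.2 h1)) (not_lt.2 h2.le)

/-- The regular boundary points of `Ω`: those where `∂Ω` is a `C¹` hypersurface with `Ω` locally on
one side of it. -/
def regularBoundary {d : ℕ} (Ω : Set (EuclideanSpace ℝ (Fin d))) :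
    Set (EuclideanSpace ℝ (Fin d)) :=
  {p | p ∈ frontier Ω ∧ ∃ v, IsUnitOutwardNormal Ω p v}

open Classical in
/-- The unit outward normal field `n` of `Ω` (with value `0` where there is no normal). -/
def outwardNormal {d : ℕ} (Ω : Set (EuclideanSpace ℝ (Fin d)))
    (p : EuclideanSpace ℝ (Fin d)) : EuclideanSpace ℝ (Fin d) :=
  if h : ∃ v, IsUnitOutwardNormal Ω p v then h.choose else 0

/-- A bounded region with piecewise `C¹` boundary: `Ω` is bounded, open and connected, `∂Ω` has
finite `(d-1)`-dimensional area, and all points of `∂Ω` outside a set of area zero (edges,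
vertices, ...) are regular. Area is the Hausdorff measure in the Euclidean normalization. -/
structure IsPiecewiseC1Region {d : ℕ} (Ω : Set (EuclideanSpace ℝ (Fin d))) : Prop where
  isOpen : IsOpen Ω
  isConnected : IsConnected Ω
  isBounded : Bornology.IsBounded Ω
  area_lt_top : μHE[d - 1] (frontier Ω) < ⊤
  area_singular : μHE[d - 1] (frontier Ω \ regularBoundary Ω) = 0

/-- The divergence `∇ · F = ∑ i, ∂F_i/∂x_i` of a complex vector field on `ℝ^d`. -/
def divergence {d : ℕ} (F : EuclideanSpace ℝ (Fin d) → Fin d → ℂ)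
    (x : EuclideanSpace ℝ (Fin d)) : ℂ :=
  ∑ i, fderiv ℝ (fun y => F y i) x (EuclideanSpace.single i 1)

/-- `σ_0 = f`, `σ_k = g^(ν+k) ∇ · [ ∇g / (|∇g|² g^(ν+k)) σ_{k-1} ]`. -/
def hankelSigma {d : ℕ} (ν : ℂ) (f g : EuclideanSpace ℝ (Fin d) → ℝ) :
    ℕ → EuclideanSpace ℝ (Fin d) → ℂ
  | 0 => fun x => (f x : ℂ)
  | k + 1 => fun x => (g x : ℂ) ^ (ν + (k + 1 : ℕ)) *
      divergence (fun y i =>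
        ((∇ g y i : ℝ) : ℂ) / (((‖∇ g y‖ ^ 2 : ℝ) : ℂ) * (g y : ℂ) ^ (ν + (k + 1 : ℕ))) *
          hankelSigma ν f g k y) x

/-- The integrand `f J_ν(ω g)` of the multivariate Hankel transform. -/
def hankelIntegrand {d : ℕ} (ν : ℂ) (f g : EuclideanSpace ℝ (Fin d) → ℝ) (ω : ℝ)
    (x : EuclideanSpace ℝ (Fin d)) : ℂ :=
  (f x : ℂ) * besselJ ν ((ω * g x : ℝ) : ℂ)

/-- The boundary integrand `(∇g · n / |∇g|²) σ_{k-1} J_{ν+k}(ω g)`, for `k ≥ 1`. -/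
def hankelBoundaryIntegrand {d : ℕ} (ν : ℂ) (f g : EuclideanSpace ℝ (Fin d) → ℝ)
    (Ω : Set (EuclideanSpace ℝ (Fin d))) (k : ℕ) (ω : ℝ) (x : EuclideanSpace ℝ (Fin d)) : ℂ :=
  ((inner ℝ (∇ g x) (outwardNormal Ω x) / ‖∇ g x‖ ^ 2 : ℝ) : ℂ) *
    hankelSigma ν f g (k - 1) x * besselJ (ν + k) ((ω * g x : ℝ) : ℂ)

end

/-! Write `μ = ν + k + 1`. Since `d/dt [t^μ J_μ(ωt)] = ω t^μ J_{μ-1}(ωt)`, the vector field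
`∇g/(|∇g|² g^μ) · σ_k · g^μ J_μ(ωg)` has divergence `σ_{k+1} J_μ(ωg) + ω σ_k J_{μ-1}(ωg)`: the
definition of `σ_{k+1}` is made for this. Its normal component is the boundary integrand of index `k
+ 1`, so the divergence theorem gives an exact recursion between the integrals of `σ_k J_{ν+k}(ωg)`
and `σ_{k+1} J_{ν+k+1}(ωg)`. Iterating it `s` times yields the expansion with an exact remainder. As
`|g|` is bounded below on the closure, `J_μ(x) = O(|x|^{-1/2})` bounds every integral by `ω^{-1/2}`;
one further step of the recursion in the remainder gains the missing factor `1/ω`. No oscillation of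
the integrals is exploited, so resonance points play no role.

Two ingredients carry the weight. The Bessel decay comes from an energy estimate for the equation
satisfied by `√x J_μ(x)`.

The divergence theorem for piecewise `C¹` regions is proved without charts or area formula. Near a
regular point `p` with normal `n`, take a unit direction `e` with `|e - n| = O(η)`. On each line
parallel to `e`, the fundamental theorem of calculus turns the integral of `∂_e h` over `Ω` into the
value of `h` where the line leaves `Ω`. Projecting the boundary along `e` distorts area by a factor
`1 + O(η²)`, and `e · n(x) = 1 + O(η²)`. Hence the divergence theorem in direction `e` has relative
error `O(η²)`. The defect is linear in the direction, and `η v = (n + η v) - n` is a difference of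
near-normal directions, so an arbitrary `v` has relative error `O(η²)/η = O(η)`. A partition of
unity makes this global away from the singular set while keeping the relative error; then `η → 0`
shows that the defect vanishes. The singular set is compact and null in codimension one, so cutoffs
whose gradients are small in `L¹` remove it. -/

noncomputable section

/-! ### The Bessel series and its entire factor -/

/-- The coefficients of the entire function `w ↦ (z / 2) ^ (-ν) * J_ν(z)`, `w = (z / 2) ^ 2`. -/
def besselCoeff (ν : ℂ) (m : ℕ) : ℂ := (-1) ^ m / ((m ! : ℂ) * Complex.Gamma (ν + m + 1))

/-- The entire function `Λ_ν` with `J_ν(z) = (z / 2) ^ ν * Λ_ν((z / 2) ^ 2)`. -/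
def besselEntire (ν w : ℂ) : ℂ := ∑' m : ℕ, besselCoeff ν m * w ^ m

theorem besselJ_eq (ν z : ℂ) : besselJ ν z = (z / 2) ^ ν * besselEntire ν ((z / 2) ^ 2) := by
  simp only [besselJ, besselEntire, besselCoeff, pow_mul]

theorem succ_mul_besselCoeff_succ (ν : ℂ) (m : ℕ) :
    ((m : ℂ) + 1) * besselCoeff ν (m + 1) = -besselCoeff (ν + 1) m := by
  have h1 : ((m : ℂ) + 1) ≠ 0 := by exact_mod_cast Nat.succ_ne_zero m
  have h2 : ((m ! : ℕ) : ℂ) ≠ 0 := by exact_mod_cast Nat.factorial_ne_zero m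
  have h3 : ν + ((m + 1 : ℕ) : ℂ) + 1 = ν + 1 + m + 1 := by push_cast; ring
  rw [besselCoeff, besselCoeff, h3, Nat.factorial_succ]
  push_cast
  -- At a pole `Complex.Gamma` takes the value 0. Both coefficients contain this same value, so both
  -- sides vanish through division by 0.
  rcases eq_or_ne (Complex.Gamma (ν + 1 + m + 1)) 0 with h | h
  · simp [h]
  · field_simp
    ring

/-- The identity `1/Γ(z) = z/Γ(z + 1)` holds at the poles as well, so no exception is needed for any
`ν`. -/
theorem add_mul_besselCoeff (ν : ℂ) (m : ℕ) :
    (ν + m) * besselCoeff ν m = besselCoeff (ν - 1) m := by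
  have h3 : ν - 1 + (m : ℂ) + 1 = ν + m := by ring
  have h := Complex.one_div_Gamma_eq_self_mul_one_div_Gamma_add_one (ν + m)
  simp only [besselCoeff, h3, div_eq_mul_inv, mul_inv, h]
  ring

/-- The same functional equation makes `|1/Γ(ν + m + 1)|` nonincreasing in `m` as soon as `|ν + m +
1| ≥ 1`. Only finitely many terms precede that range, and their sum is the bound. -/
theorem exists_norm_inv_Gamma_le (ν : ℂ) :
    ∃ C : ℝ, 0 ≤ C ∧ ∀ m : ℕ, ‖(Complex.Gamma (ν + m + 1))⁻¹‖ ≤ C := by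
  obtain ⟨N, hN⟩ := exists_nat_ge (‖ν‖ + 1)
  set a : ℕ → ℝ := fun m => ‖(Complex.Gamma (ν + m + 1))⁻¹‖ with ha
  have hstep : ∀ m, N ≤ m → a (m + 1) ≤ a m := by
    intro m hm
    have h := Complex.one_div_Gamma_eq_self_mul_one_div_Gamma_add_one (ν + m + 1)
    have h3 : ν + ((m + 1 : ℕ) : ℂ) + 1 = ν + m + 1 + 1 := by push_cast; ring
    have h1 : 1 ≤ ‖ν + m + 1‖ := by
      have e : (((m : ℝ) + 1 : ℝ) : ℂ) = (ν + m + 1) - ν := by push_cast; ring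
      have h5 : (m : ℝ) + 1 ≤ ‖ν + m + 1‖ + ‖ν‖ := by
        calc (m : ℝ) + 1 = ‖(((m : ℝ) + 1 : ℝ) : ℂ)‖ := by
              rw [Complex.norm_real, Real.norm_of_nonneg (by positivity)]
          _ ≤ _ := by rw [e]; exact norm_sub_le _ _
      have h6 : (N : ℝ) ≤ m := by exact_mod_cast hm
      linarith
    simp only [ha, h3]
    rw [h, norm_mul]
    exact le_mul_of_one_le_left (norm_nonneg _) h1
  refine ⟨∑ m ∈ Finset.range (N + 1), a m, Finset.sum_nonneg fun _ _ => norm_nonneg _, ?_⟩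
  have hsmall : ∀ m, m ≤ N → a m ≤ ∑ m ∈ Finset.range (N + 1), a m := fun m hm =>
    Finset.single_le_sum (f := a) (fun _ _ => norm_nonneg _)
      (Finset.mem_range.2 (Nat.lt_succ_of_le hm))
  intro m
  rcases le_total m N with hm | hm
  · exact hsmall m hm
  · induction m, hm using Nat.le_induction with
    | base => exact hsmall N le_rfl
    | succ k hk ih => exact (hstep k hk).trans ih

theorem exists_norm_besselCoeff_le (ν : ℂ) :
    ∃ C : ℝ, 0 ≤ C ∧ ∀ m : ℕ, ‖besselCoeff ν m‖ ≤ C / m ! := by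
  obtain ⟨C, hC, h⟩ := exists_norm_inv_Gamma_le ν
  refine ⟨C, hC, fun m => ?_⟩
  have : besselCoeff ν m = (-1) ^ m * ((m ! : ℂ)⁻¹ * (Complex.Gamma (ν + m + 1))⁻¹) := by
    rw [besselCoeff, div_eq_mul_inv, mul_inv]
  rw [this, norm_mul, norm_pow, norm_neg, norm_one, one_pow, one_mul, norm_mul, norm_inv,
    Complex.norm_natCast, div_eq_inv_mul]
  exact mul_le_mul_of_nonneg_left (h m) (by positivity)

theorem summable_besselCoeff_mul_pow (ν w : ℂ) : Summable fun m => besselCoeff ν m * w ^ m := by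
  obtain ⟨C, hC, h⟩ := exists_norm_besselCoeff_le ν
  refine Summable.of_norm_bounded ((Real.summable_pow_div_factorial ‖w‖).mul_left C) fun m => ?_
  rw [norm_mul, norm_pow]
  calc _ ≤ C / m ! * ‖w‖ ^ m := mul_le_mul_of_nonneg_right (h m) (by positivity)
    _ = _ := by ring

/-- Termwise differentiation on the ball of radius `‖w‖ + 1`, with exponential-series majorant. The
coefficient shift identifies the differentiated series with the one for `ν + 1`. -/
theorem hasDerivAt_besselEntire (ν w : ℂ) :
    HasDerivAt (besselEntire ν) (-besselEntire (ν + 1) w) w := by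
  obtain ⟨C, hC, h⟩ := exists_norm_besselCoeff_le (ν + 1)
  set R := ‖w‖ + 1
  have hR : 0 ≤ R := by positivity
  -- The constant term differentiates to 0; all other indices drop by one.
  set u : ℕ → ℝ := fun m => match m with
    | 0 => 0
    | k + 1 => C * (R ^ k / k !) with hu
  have hus : Summable u := by
    rw [← summable_nat_add_iff 1]
    exact (Real.summable_pow_div_factorial R).mul_left C
  have hterm : ∀ (m : ℕ) (y : ℂ), besselCoeff ν (m + 1) * (((m + 1 : ℕ) : ℂ) * y ^ m)
      = -(besselCoeff (ν + 1) m * y ^ m) := by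
    intro m y
    have := succ_mul_besselCoeff_succ ν m
    push_cast
    linear_combination y ^ m * this
  have key := hasDerivAt_tsum_of_isPreconnected (𝕜 := ℂ) (F := ℂ) (u := u) (t := Metric.ball 0 R)
    (g := fun m y => besselCoeff ν m * y ^ m)
    (g' := fun m y => besselCoeff ν m * ((m : ℂ) * y ^ (m - 1))) (y₀ := 0) (y := w) hus
    Metric.isOpen_ball (convex_ball _ _).isPreconnected
    (fun n y _ => (hasDerivAt_pow n y).const_mul _) (fun n y hy => ?_)
    (Metric.mem_ball_self (by positivity)) (summable_besselCoeff_mul_pow ν 0) (by simp [R])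
  · convert! key using 1
    have hz : besselCoeff ν 0 * (((0 : ℕ) : ℂ) * w ^ (0 - 1)) = 0 := by simp
    have hs : Summable fun m : ℕ => besselCoeff ν m * ((m : ℂ) * w ^ (m - 1)) := by
      rw [← summable_nat_add_iff 1]
      simp only [Nat.add_sub_cancel, hterm]
      exact (summable_besselCoeff_mul_pow _ _).neg
    rw [hs.tsum_eq_zero_add, hz, zero_add]
    simp only [Nat.add_sub_cancel, hterm, tsum_neg]
    rfl
  · rcases n with _ | k
    · simp [hu]
    · simp only [Nat.add_sub_cancel, hterm, norm_neg, norm_mul, norm_pow, hu]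
      have hy' : ‖y‖ ≤ R := by simpa using (mem_ball_zero_iff.1 hy).le
      calc _ ≤ C / k ! * R ^ k := by gcongr; exact h k
        _ = _ := by ring

/-- Apply `ν + w d/dw` to the series: it multiplies the `m`-th term by `ν + m`, which lowers the
order by one, while the derivative is already known to be `-Λ_{ν+1}`. -/
theorem besselEntire_recurrence (ν w : ℂ) :
    ν * besselEntire ν w - w * besselEntire (ν + 1) w = besselEntire (ν - 1) w := by
  have hs := summable_besselCoeff_mul_pow ν w
  have hterm : ∀ m : ℕ, besselCoeff ν (m + 1) * (((m + 1 : ℕ) : ℂ) * w ^ (m + 1))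
      = -(w * (besselCoeff (ν + 1) m * w ^ m)) := by
    intro m
    have := succ_mul_besselCoeff_succ ν m
    push_cast
    linear_combination w ^ (m + 1) * this
  have hsd : Summable fun m : ℕ => besselCoeff ν m * ((m : ℂ) * w ^ m) := by
    rw [← summable_nat_add_iff 1]
    simp only [hterm]
    exact ((summable_besselCoeff_mul_pow _ _).mul_left w).neg
  have h2 : ∑' m : ℕ, besselCoeff ν m * ((m : ℂ) * w ^ m) = -(w * besselEntire (ν + 1) w) := by
    rw [hsd.tsum_eq_zero_add]
    simp only [hterm, tsum_neg, tsum_mul_left, besselEntire]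
    simp
  rw [sub_eq_add_neg, ← h2, besselEntire, ← tsum_mul_left, ← (hs.mul_left ν).tsum_add hsd]
  refine tsum_congr fun m => ?_
  rw [← add_mul_besselCoeff]
  ring

theorem differentiable_besselEntire (ν : ℂ) : Differentiable ℂ (besselEntire ν) :=
  fun w => (hasDerivAt_besselEntire ν w).differentiableAt

/-! ### Powers and Bessel functions on the punctured real line -/

/-- On the punctured real line, a complex power is locally a multiple of `exp (μ log |t|)`. -/
theorem exists_ofReal_cpow_eventuallyEq (μ : ℂ) {t : ℝ} (ht : t ≠ 0) :
    ∃ c : ℂ, ∀ᶠ s : ℝ in 𝓝 t, (s : ℂ) ^ μ = Complex.exp (μ * (Real.log s : ℝ)) * c := by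
  refine ⟨Complex.exp (μ * ((t : ℂ).arg * Complex.I)), ?_⟩
  have harg : ∀ᶠ s : ℝ in 𝓝 t, s ≠ 0 ∧ (s : ℂ).arg = (t : ℂ).arg := by
    rcases lt_or_gt_of_ne ht with h | h
    · filter_upwards [gt_mem_nhds h] with s hs
      exact ⟨hs.ne, by rw [Complex.arg_ofReal_of_neg hs, Complex.arg_ofReal_of_neg h]⟩
    · filter_upwards [lt_mem_nhds h] with s hs
      exact ⟨hs.ne', by rw [Complex.arg_ofReal_of_nonneg hs.le, Complex.arg_ofReal_of_nonneg h.le]⟩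
  filter_upwards [harg] with s hs
  rw [Complex.cpow_def_of_ne_zero (by exact_mod_cast hs.1), ← Complex.exp_add, Complex.log, hs.2,
    Complex.norm_real, Real.norm_eq_abs, Real.log_abs]
  ring_nf

theorem contDiffAt_ofReal_cpow (μ : ℂ) {t : ℝ} (ht : t ≠ 0) {n : WithTop ℕ∞} :
    ContDiffAt ℝ n (fun s : ℝ => (s : ℂ) ^ μ) t := by
  obtain ⟨c, hc⟩ := exists_ofReal_cpow_eventuallyEq μ ht
  refine ContDiffAt.congr_of_eventuallyEq ?_ hc
  have : ContDiffAt ℝ n (fun s : ℝ => ((Real.log s : ℝ) : ℂ)) t :=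
    Complex.ofRealCLM.contDiff.contDiffAt.comp t (Real.contDiffAt_log.2 ht)
  exact ((contDiffAt_const.mul this).cexp).mul contDiffAt_const

theorem hasDerivAt_ofReal_cpow (μ : ℂ) {t : ℝ} (ht : t ≠ 0) :
    HasDerivAt (fun s : ℝ => (s : ℂ) ^ μ) (μ * (t : ℂ) ^ μ / t) t := by
  obtain ⟨c, hc⟩ := exists_ofReal_cpow_eventuallyEq μ ht
  have h1 : HasDerivAt (fun s : ℝ => ((Real.log s : ℝ) : ℂ)) ((t⁻¹ : ℝ) : ℂ) t :=
    (Real.hasDerivAt_log ht).ofReal_comp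
  have h2 := (((h1.const_mul μ).cexp).mul_const c).congr_of_eventuallyEq hc
  convert! h2 using 1
  rw [hc.self_of_nhds]
  push_cast
  ring

theorem contDiff_besselEntire (ν : ℂ) {n : WithTop ℕ∞} : ContDiff ℝ n (besselEntire ν) :=
  ((differentiable_besselEntire ν).contDiff (n := n)).restrict_scalars ℝ

theorem contDiffAt_besselJ_ofReal (ν : ℂ) {t : ℝ} (ht : t ≠ 0) {n : WithTop ℕ∞} :
    ContDiffAt ℝ n (fun s : ℝ => besselJ ν (s : ℂ)) t := by
  have h0 : ContDiffAt ℝ n (fun s : ℝ => s / 2) t := contDiffAt_id.div_const 2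
  have h1 : ContDiffAt ℝ n (fun s : ℝ => ((s / 2 : ℝ) : ℂ) ^ ν) t :=
    ContDiffAt.comp (g := fun s : ℝ => (s : ℂ) ^ ν) t
      (contDiffAt_ofReal_cpow ν (div_ne_zero ht two_ne_zero)) h0
  have h2 : ContDiffAt ℝ n (fun s : ℝ => besselEntire ν (((s / 2 : ℝ) : ℂ) ^ 2)) t :=
    (contDiff_besselEntire ν).contDiffAt.comp t
      ((Complex.ofRealCLM.contDiff.contDiffAt.comp t h0).pow 2)
  refine (h1.mul h2).congr_of_eventuallyEq (Eventually.of_forall fun s => ?_)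
  simp only [besselJ_eq]
  push_cast
  rfl

/-- `d/dt [t ^ μ J_μ(ω t)] = ω t ^ μ J_{μ - 1}(ω t)`. -/
theorem hasDerivAt_cpow_mul_besselJ (μ : ℂ) {ω t : ℝ} (hω : ω ≠ 0) (ht : t ≠ 0) :
    HasDerivAt (fun s : ℝ => (s : ℂ) ^ μ * besselJ μ ((ω * s : ℝ) : ℂ))
      (ω * ((t : ℂ) ^ μ * besselJ (μ - 1) ((ω * t : ℝ) : ℂ))) t := by
  have hne : ω * t / 2 ≠ 0 := div_ne_zero (mul_ne_zero hω ht) two_ne_zero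
  have hA := hasDerivAt_ofReal_cpow μ ht
  have hl : HasDerivAt (fun s : ℝ => ω * s / 2) (ω / 2) t := by
    simpa using ((hasDerivAt_id t).const_mul ω).div_const 2
  have hB : HasDerivAt (fun s : ℝ => ((ω * s / 2 : ℝ) : ℂ) ^ μ)
      ((ω / 2) • (μ * ((ω * t / 2 : ℝ) : ℂ) ^ μ / (ω * t / 2 : ℝ))) t :=
    HasDerivAt.scomp (g₁ := fun y : ℝ => (y : ℂ) ^ μ) t (hasDerivAt_ofReal_cpow μ hne) hl
  have hq : HasDerivAt (fun s : ℝ => ((ω * s / 2 : ℝ) : ℂ) ^ 2)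
      (2 * ((ω * t / 2 : ℝ) : ℂ) * ((ω / 2 : ℝ) : ℂ)) t := by
    convert! hl.ofReal_comp.pow 2 using 1
    simp
  have hC := (hasDerivAt_besselEntire μ (((ω * t / 2 : ℝ) : ℂ) ^ 2)).comp t hq
  have h := hA.mul (hB.mul hC)
  have e : (fun s : ℝ => (s : ℂ) ^ μ * besselJ μ ((ω * s : ℝ) : ℂ)) =
      fun s : ℝ => (s : ℂ) ^ μ * (((ω * s / 2 : ℝ) : ℂ) ^ μ *
        besselEntire μ (((ω * s / 2 : ℝ) : ℂ) ^ 2)) := by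
    funext s
    rw [besselJ_eq]
    push_cast
    rfl
  rw [e]
  convert! h using 1
  have e2 : (((ω * t : ℝ) : ℂ) / 2) = ((ω * t / 2 : ℝ) : ℂ) := by push_cast; rfl
  have hrec := besselEntire_recurrence μ (((ω * t / 2 : ℝ) : ℂ) ^ 2)
  have hwC : ((ω * t / 2 : ℝ) : ℂ) ≠ 0 := by exact_mod_cast hne
  have htC : (t : ℂ) ≠ 0 := by exact_mod_cast ht
  have hωC : (ω : ℂ) ≠ 0 := by exact_mod_cast hω
  -- Writing `J_{μ-1}` through `Λ_μ` and `Λ_{μ+1}` reduces the claim to an algebraic identity.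
  rw [besselJ_eq, e2, Complex.cpow_sub _ _ hwC, Complex.cpow_one, ← hrec]
  simp only [Pi.mul_apply, Function.comp_apply, Complex.real_smul]
  set B := ((ω * t / 2 : ℝ) : ℂ) ^ μ
  set L := besselEntire μ (((ω * t / 2 : ℝ) : ℂ) ^ 2)
  set L' := besselEntire (μ + 1) (((ω * t / 2 : ℝ) : ℂ) ^ 2)
  push_cast
  field_simp
  ring

/-- Up to a constant, `u` is `√x J_μ(x)`, and `v = u'`. It satisfies `u'' = (c/x² - 1) u` with `c =
μ² - 1/4`, a perturbation of the harmonic oscillator that is integrable at infinity. The energy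
`|u|² + |u'|²` therefore stays bounded on `[1, ∞)`. -/
theorem exists_norm_besselJ_le_of_pos (μ : ℂ) :
    ∃ C : ℝ, 0 ≤ C ∧ ∀ x : ℝ, 1 ≤ x → ‖besselJ μ (x : ℂ)‖ ≤ C * x ^ (-(1 / 2) : ℝ) := by
  set κ : ℂ := μ + 1 / 2 with hκ
  set w : ℝ → ℂ := fun x => ((x / 2 : ℝ) : ℂ) ^ 2 with hw
  set u : ℝ → ℂ := fun x => (x : ℂ) ^ κ * besselEntire μ (w x) with hu
  set v : ℝ → ℂ := fun x => κ * (x : ℂ) ^ κ / x * besselEntire μ (w x)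
    - (x : ℂ) ^ κ * (((x / 2 : ℝ) : ℂ) * besselEntire (μ + 1) (w x)) with hv
  set c : ℂ := κ * (κ - 1) with hc
  have hwd : ∀ x : ℝ, HasDerivAt w ((x / 2 : ℝ) : ℂ) x := by
    intro x
    have h := (((hasDerivAt_id x).div_const 2).ofReal_comp).pow 2
    convert! h using 1
    simp
    ring
  have hLd : ∀ (α : ℂ) (x : ℝ), HasDerivAt (fun y => besselEntire α (w y))
      (-besselEntire (α + 1) (w x) * ((x / 2 : ℝ) : ℂ)) x := fun α x =>
    (hasDerivAt_besselEntire α (w x)).comp x (hwd x)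
  have hud : ∀ x : ℝ, 0 < x → HasDerivAt u (v x) x := by
    intro x hx
    convert! (hasDerivAt_ofReal_cpow κ hx.ne').mul (hLd μ x) using 1
    simp only [hv]
    ring
  have hvd : ∀ x : ℝ, 0 < x → HasDerivAt v ((c / x ^ 2 - 1) * u x) x := by
    intro x hx
    have hxC : (x : ℂ) ≠ 0 := by exact_mod_cast hx.ne'
    have hid : HasDerivAt (fun y : ℝ => (y : ℂ)) 1 x := by
      simpa using (hasDerivAt_id x).ofReal_comp
    have hh : HasDerivAt (fun y : ℝ => ((y / 2 : ℝ) : ℂ)) (1 / 2) x := by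
      simpa using ((hasDerivAt_id x).div_const 2).ofReal_comp
    have hQ := hasDerivAt_ofReal_cpow κ hx.ne'
    have h := (((hQ.const_mul κ).div hid hxC).mul (hLd μ x)).sub
      (hQ.mul (hh.mul (hLd (μ + 1) x)))
    convert! h using 1
    -- Differentiating `Λ_{μ+1}` produces `Λ_{μ+2}`; the recurrence ties it to `Λ_{μ+1}` and `Λ_μ`,
    -- so that `v'` closes up to a multiple of `u`.
    have hrec := besselEntire_recurrence (μ + 1) (w x)
    rw [add_sub_cancel_right] at hrec
    simp only [hu, Pi.mul_apply, Pi.div_apply]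
    rw [← hrec]
    simp only [hw, hc, hκ]
    push_cast
    field_simp
    ring
  set N : ℝ → ℝ := fun x => ‖u x‖ ^ 2 + ‖v x‖ ^ 2 with hN
  have hNd : ∀ x : ℝ, 0 < x → HasDerivAt N (2 * inner ℝ (v x) ((c / x ^ 2) * u x)) x := by
    intro x hx
    convert! (hud x hx).norm_sq.add (hvd x hx).norm_sq using 1
    have e : (c / x ^ 2 - 1) * u x = (c / x ^ 2) * u x - u x := by ring
    rw [e, inner_sub_right (v x), real_inner_comm (v x) (u x)]
    ring
  -- Since `N' ≤ (‖c‖/x²) N`, the integrating factor `exp(‖c‖/x)` makes `M` nonincreasing.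
  set M : ℝ → ℝ := fun x => N x * Real.exp (‖c‖ / x) with hM
  have hMd : ∀ x : ℝ, 0 < x → HasDerivAt M ((2 * inner ℝ (v x) ((c / x ^ 2) * u x)) *
      Real.exp (‖c‖ / x) + N x * (Real.exp (‖c‖ / x) * (-‖c‖ / x ^ 2))) x := by
    intro x hx
    have h1 : HasDerivAt (fun y : ℝ => ‖c‖ / y) (-‖c‖ / x ^ 2) x := by
      simpa [div_eq_mul_inv] using (hasDerivAt_inv hx.ne').const_mul ‖c‖
    exact (hNd x hx).mul h1.exp
  have hanti : AntitoneOn M (Set.Ici 1) := by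
    have hpos : ∀ x ∈ Set.Ici (1 : ℝ), 0 < x := fun x hx => lt_of_lt_of_le one_pos hx
    refine antitoneOn_of_deriv_nonpos (convex_Ici 1)
      (fun x hx => (hMd x (hpos x hx)).continuousAt.continuousWithinAt)
      (fun x hx => (hMd x (hpos x (interior_subset hx))).differentiableAt.differentiableWithinAt)
      fun x hx => ?_
    have hx0 := hpos x (interior_subset hx)
    rw [(hMd x hx0).deriv]
    have h1 : inner ℝ (v x) ((c / x ^ 2) * u x) ≤ ‖c‖ / x ^ 2 * (‖u x‖ * ‖v x‖) := by
      refine (real_inner_le_norm _ _).trans (le_of_eq ?_)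
      rw [norm_mul, norm_div, norm_pow, Complex.norm_real, Real.norm_of_nonneg hx0.le]
      ring
    have h2 : 2 * (‖u x‖ * ‖v x‖) ≤ N x := by
      simp only [hN]
      nlinarith [sq_nonneg (‖u x‖ - ‖v x‖)]
    have h3 : 0 ≤ ‖c‖ / x ^ 2 := by positivity
    have h4 : 2 * inner ℝ (v x) ((c / x ^ 2) * u x) ≤ ‖c‖ / x ^ 2 * N x := by
      nlinarith [mul_le_mul_of_nonneg_left h2 h3]
    have h5 := mul_le_mul_of_nonneg_right h4 (Real.exp_pos (‖c‖ / x)).le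
    have h6 : N x * (Real.exp (‖c‖ / x) * (-‖c‖ / x ^ 2)) =
      -(‖c‖ / x ^ 2 * N x * Real.exp (‖c‖ / x)) := by ring
    linarith
  have hbound : ∀ x : ℝ, 1 ≤ x → ‖u x‖ ≤ Real.sqrt (M 1) := by
    intro x hx
    refine Real.le_sqrt_of_sq_le ?_
    refine le_trans ?_ (hanti Set.self_mem_Ici hx hx)
    have h1 : 1 ≤ Real.exp (‖c‖ / x) := Real.one_le_exp (by positivity)
    have h2 : 0 ≤ N x := by positivity
    calc ‖u x‖ ^ 2 ≤ N x := by simp only [hN]; nlinarith [sq_nonneg ‖v x‖]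
      _ ≤ M x := le_mul_of_one_le_right h2 h1
  refine ⟨‖((1 / 2 : ℝ) : ℂ) ^ μ‖ * Real.sqrt (M 1), by positivity, fun x hx => ?_⟩
  have hx0 : 0 < x := lt_of_lt_of_le one_pos hx
  have hxC : (x : ℂ) ≠ 0 := by exact_mod_cast hx0.ne'
  have e : besselJ μ (x : ℂ) = ((1 / 2 : ℝ) : ℂ) ^ μ * u x * (x : ℂ) ^ (-(1 / 2) : ℂ) := by
    have e1 : (x : ℂ) / 2 = (x : ℝ) * ((1 / 2 : ℝ) : ℂ) := by push_cast; ring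
    have e2 : (x : ℂ) ^ μ = (x : ℂ) ^ κ * (x : ℂ) ^ (-(1 / 2) : ℂ) := by
      rw [← Complex.cpow_add _ _ hxC, hκ]
      ring_nf
    rw [besselJ_eq, e1, Complex.mul_cpow_ofReal_nonneg hx0.le (by norm_num), e2]
    simp only [hu, hw]
    push_cast
    ring_nf
  have e3 : ‖(x : ℂ) ^ (-(1 / 2) : ℂ)‖ = x ^ (-(1 / 2) : ℝ) := by
    rw [Complex.norm_cpow_eq_rpow_re_of_pos hx0]
    norm_num
  rw [e, norm_mul, norm_mul, e3]
  gcongr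
  exact hbound x hx

/-- The decay of the Bessel function along the real line. -/
theorem exists_norm_besselJ_le (μ : ℂ) :
    ∃ C : ℝ, 0 ≤ C ∧ ∀ x : ℝ, 1 ≤ |x| → ‖besselJ μ (x : ℂ)‖ ≤ C * |x| ^ (-(1 / 2) : ℝ) := by
  obtain ⟨C, hC, h⟩ := exists_norm_besselJ_le_of_pos μ
  set K := ‖Complex.exp (Real.pi * Complex.I * μ)‖
  refine ⟨max C (K * C), le_max_of_le_left hC, fun x hx => ?_⟩
  rcases le_total 0 x with h0 | h0
  · rw [abs_of_nonneg h0] at hx ⊢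
    exact (h x hx).trans (by gcongr; exact le_max_left _ _)
  · rw [abs_of_nonpos h0] at hx ⊢
    -- On the negative axis the principal power contributes the fixed factor `exp(iπμ)`; the entire
    -- factor depends only on the square.
    have e : besselJ μ (x : ℂ) = Complex.exp (Real.pi * Complex.I * μ) * besselJ μ ((-x : ℝ) : ℂ) := by
      have e1 : (x : ℂ) / 2 = ((x / 2 : ℝ) : ℂ) := by push_cast; rfl
      have e2 : ((-x : ℝ) : ℂ) / 2 = -((x / 2 : ℝ) : ℂ) := by push_cast; ring
      rw [besselJ_eq, besselJ_eq, e1, e2, Complex.ofReal_cpow_of_nonpos (by linarith), neg_sq]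
      ring
    rw [e, norm_mul]
    calc _ ≤ K * (C * (-x) ^ (-(1 / 2) : ℝ)) := by gcongr; exact h _ hx
      _ = K * C * (-x) ^ (-(1 / 2) : ℝ) := by ring
      _ ≤ _ := by gcongr; exact le_max_right _ _

end

/-! ### Slicing along a direction -/

section Slicing

variable {V : Type*} [NormedAddCommGroup V] [InnerProductSpace ℝ V]

theorem inner_smul_add_orthogonalProjectionOnto {e : V} (he : ‖e‖ = 1) (x : V) :
    inner ℝ e x • e + ((ℝ ∙ e)ᗮ.orthogonalProjectionOnto x : V) = x := by
  have h := Submodule.starProjection_add_starProjection_orthogonal (K := ℝ ∙ e) x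
  rwa [Submodule.starProjection_unit_singleton ℝ he] at h

theorem norm_sq_eq_inner_sq_add_norm_orthogonalProjectionOnto_sq {e : V} (he : ‖e‖ = 1) (x : V) :
    ‖x‖ ^ 2 = inner ℝ e x ^ 2 + ‖(ℝ ∙ e)ᗮ.orthogonalProjectionOnto x‖ ^ 2 := by
  have h := Submodule.norm_sq_eq_add_norm_sq_projection x (ℝ ∙ e)
  have h2 : ‖(ℝ ∙ e).orthogonalProjectionOnto x‖ = |inner ℝ e x| := by
    rw [← Submodule.norm_coe, ← Submodule.starProjection_apply,
      Submodule.starProjection_unit_singleton ℝ he, norm_smul, he, mul_one, Real.norm_eq_abs]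
  rw [h, h2, sq_abs]

theorem isClosedEmbedding_smul_add {e : V} (he : ‖e‖ = 1) (y : V) :
    IsClosedEmbedding (fun t : ℝ => t • e + y) := by
  refine Isometry.isClosedEmbedding (Isometry.of_dist_eq fun s t => ?_)
  rw [dist_add_right, dist_eq_norm, ← sub_smul, norm_smul, he, mul_one, Real.dist_eq,
    Real.norm_eq_abs]

theorem hasDerivAt_comp_smul_add {h : V → ℂ} (hh : ContDiff ℝ 1 h) (e y : V) (t : ℝ) :
    HasDerivAt (fun t : ℝ => h (t • e + y)) (fderiv ℝ h (t • e + y) e) t := by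
  have h1 : HasDerivAt (fun t : ℝ => t • e + y) e t := by
    simpa using ((hasDerivAt_id t).smul_const e).add_const y
  exact ((hh.differentiable one_ne_zero _).hasFDerivAt).comp_hasDerivAt t h1

variable [FiniteDimensional ℝ V] [MeasurableSpace V] [BorelSpace V]

/-- The orthogonal splitting of `V` into the line through `e` and its complement preserves volume;
this is what permits Fubini along lines parallel to `e`. -/
theorem measurePreserving_smul_add {e : V} (he : ‖e‖ = 1) :
    MeasurePreserving (fun p : ℝ × (ℝ ∙ e)ᗮ => p.1 • e + (p.2 : V)) (volume.prod volume) volume := by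
  have h1 := (LinearIsometryEquiv.toSpanUnitSingleton (𝕜 := ℝ) e he).measurePreserving.prod
    (MeasurePreserving.id (volume : Measure (ℝ ∙ e)ᗮ))
  have h2 := ((ℝ ∙ e).measurePreserving_measurableEquivProd (0 : V)).symm
  rw [InnerProductSpace.euclideanHausdorffMeasure_eq_volume] at h2
  have e1 : (((ℝ ∙ e).measurableEquivProd (0 : V)).symm ∘
      Prod.map (LinearIsometryEquiv.toSpanUnitSingleton (𝕜 := ℝ) e he) id) =
      fun p : ℝ × (ℝ ∙ e)ᗮ => p.1 • e + (p.2 : V) := by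
    funext p
    simp
  rw [← e1]
  exact h2.comp h1

theorem integrable_integral_smul_add {e : V} (he : ‖e‖ = 1) {F : V → ℂ} (hF : Integrable F) :
    Integrable (fun y : (ℝ ∙ e)ᗮ => ∫ t : ℝ, F (t • e + (y : V))) :=
  ((measurePreserving_smul_add he).integrable_comp hF.aestronglyMeasurable |>.2 hF).integral_prod_right

theorem integral_eq_integral_integral_smul_add {e : V} (he : ‖e‖ = 1) {F : V → ℂ}
    (hF : Integrable F) :
    ∫ x, F x = ∫ y : (ℝ ∙ e)ᗮ, ∫ t : ℝ, F (t • e + (y : V)) := by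
  have hp := measurePreserving_smul_add he
  have h1 := (hp.integrable_comp hF.aestronglyMeasurable).2 hF
  have h2 : ∫ x, F x = ∫ p : ℝ × (ℝ ∙ e)ᗮ, F (p.1 • e + (p.2 : V)) ∂(volume.prod volume) := by
    rw [← integral_map (f := F) hp.measurable.aemeasurable, hp.map_eq]
    rw [hp.map_eq]
    exact hF.aestronglyMeasurable
  exact h2.trans (integral_prod_symm _ h1)

theorem integrable_fderiv_apply {h : V → ℂ} (hh : ContDiff ℝ 1 h) (hc : HasCompactSupport h) (v : V) :
    Integrable (fun x => fderiv ℝ h x v) := by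
  refine Continuous.integrable_of_hasCompactSupport ?_ ?_
  · exact (hh.continuous_fderiv one_ne_zero).clm_apply continuous_const
  · exact (hc.fderiv ℝ).comp_left (g := fun L : V →L[ℝ] ℂ => L v) rfl

omit [FiniteDimensional ℝ V] [MeasurableSpace V] [BorelSpace V] in
theorem integral_fderiv_smul_add_eq_zero {h : V → ℂ} (hh : ContDiff ℝ 1 h)
    (hc : HasCompactSupport h) {e : V} (he : ‖e‖ = 1) (y : V) :
    ∫ t : ℝ, fderiv ℝ h (t • e + y) e = 0 := by
  have hl := isClosedEmbedding_smul_add he y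
  have hcu : HasCompactSupport (fun t : ℝ => h (t • e + y)) := hc.comp_isClosedEmbedding hl
  have hcu' : HasCompactSupport (fun t : ℝ => fderiv ℝ h (t • e + y) e) :=
    ((hc.fderiv ℝ).comp_left (g := fun L : V →L[ℝ] ℂ => L e) rfl).comp_isClosedEmbedding hl
  refine integral_eq_zero_of_hasDerivAt_of_integrable (hasDerivAt_comp_smul_add hh e y) ?_ ?_
  · exact Continuous.integrable_of_hasCompactSupport
      (((hh.continuous_fderiv one_ne_zero).comp hl.continuous).clm_apply continuous_const) hcu'
  · exact (hh.continuous.comp hl.continuous).integrable_of_hasCompactSupport hcu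

omit [FiniteDimensional ℝ V] [MeasurableSpace V] [BorelSpace V] in
theorem setIntegral_Iio_fderiv_smul_add {h : V → ℂ} (hh : ContDiff ℝ 1 h)
    (hc : HasCompactSupport h) {e : V} (he : ‖e‖ = 1) (y : V) (s : ℝ) :
    ∫ t in Set.Iio s, fderiv ℝ h (t • e + y) e = h (s • e + y) := by
  have hl := isClosedEmbedding_smul_add he y
  have hu : ContDiff ℝ 1 (fun t : ℝ => h (t • e + y)) := by fun_prop
  have := (hc.comp_isClosedEmbedding hl).integral_Iic_deriv_eq hu s
  rw [← integral_Iic_eq_integral_Iio]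
  refine Eq.trans ?_ this
  refine integral_congr_ae (Eventually.of_forall fun t => ?_)
  exact (hasDerivAt_comp_smul_add hh e y t).deriv.symm

theorem integral_fderiv_apply_eq_zero {h : V → ℂ} (hh : ContDiff ℝ 1 h)
    (hc : HasCompactSupport h) (v : V) : ∫ x, fderiv ℝ h x v = 0 := by
  rcases eq_or_ne v 0 with rfl | hv
  · simp
  · have he : ‖‖v‖⁻¹ • v‖ = 1 := by
      rw [norm_smul, norm_inv, norm_norm, inv_mul_cancel₀ (norm_ne_zero_iff.2 hv)]
    have h1 : ∫ x, fderiv ℝ h x (‖v‖⁻¹ • v) = 0 := by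
      rw [integral_eq_integral_integral_smul_add he (integrable_fderiv_apply hh hc _)]
      simp only [integral_fderiv_smul_add_eq_zero hh hc he, integral_zero]
    simp only [map_smul, integral_smul] at h1
    exact (smul_eq_zero.1 h1).resolve_left (inv_ne_zero (norm_ne_zero_iff.2 hv))

end Slicing

/-! ### One-sided hypersurfaces transversal to a direction -/

section Transversal

variable {V : Type*} [NormedAddCommGroup V] [InnerProductSpace ℝ V]
  {Ω B : Set V} {ρ : V → ℝ} {h : V → ℂ} {e : V}

/-- Inside `B` the function `ρ` increases strictly along `e`, so the line meets `Ω ∩ B` exactly at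
the parameters in `B` below `s`. Outside `B` the derivative of `h` vanishes, and integrating over
the half-line gives the value of `h` at the exit point. -/
theorem integral_indicator_fderiv_eq_of_zero (hh : ContDiff ℝ 1 h) (hc : HasCompactSupport h)
    (hB : tsupport h ⊆ B) (he : ‖e‖ = 1) (hΩ : ∀ x ∈ B, (x ∈ Ω ↔ ρ x < 0))
    (hmono : ∀ x ∈ B, ∀ t : ℝ, 0 < t → x + t • e ∈ B → ρ x < ρ (x + t • e))
    {s : ℝ} {y : V} (hsB : s • e + y ∈ B) (hs : ρ (s • e + y) = 0) :
    ∫ t : ℝ, Ω.indicator (fun x => fderiv ℝ h x e) (t • e + y) = h (s • e + y) := by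
  rw [← setIntegral_Iio_fderiv_smul_add hh hc he y s, ← integral_indicator measurableSet_Iio]
  refine integral_congr_ae (Eventually.of_forall fun t => ?_)
  by_cases ht : t • e + y ∈ B
  · have hiff : t • e + y ∈ Ω ↔ t < s := by
      rw [hΩ _ ht]
      have hshift : ∀ a b : ℝ, a • e + y + (b - a) • e = b • e + y := fun a b => by
        rw [sub_smul]; abel
      constructor
      · intro hneg
        by_contra hts
        rcases (not_lt.1 hts).eq_or_lt with h0 | h0
        · rw [← h0, hs] at hneg
          exact lt_irrefl _ hneg
        · have := hmono _ hsB (t - s) (by linarith) (by rwa [hshift])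
          rw [hshift, hs] at this
          linarith
      · intro hts
        have := hmono _ ht (s - t) (by linarith) (by rwa [hshift])
        rwa [hshift, hs] at this
    by_cases hts : t < s
    · simp only [Set.indicator_of_mem (hiff.2 hts), Set.indicator_of_mem (Set.mem_Iio.2 hts)]
    · have h1 : t ∉ Set.Iio s := hts
      simp only [Set.indicator_of_notMem (mt hiff.1 hts), Set.indicator_of_notMem h1]
  · have : fderiv ℝ h (t • e + y) = 0 :=
      fderiv_of_notMem_tsupport ℝ fun hx => ht (hB hx)
    simp [Set.indicator_apply, this]

/-- The line meets the convex set `B` in an interval on which `ρ` is continuous without zeros, hence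
of constant sign. The part in `B` lies wholly inside or wholly outside `Ω`, and a compactly
supported function has total derivative integral 0. -/
theorem integral_indicator_fderiv_eq_zero (hh : ContDiff ℝ 1 h) (hc : HasCompactSupport h)
    (hB : tsupport h ⊆ B) (he : ‖e‖ = 1) (hΩ : ∀ x ∈ B, (x ∈ Ω ↔ ρ x < 0))
    (hBc : Convex ℝ B) (hρ : ContinuousOn ρ B) {y : V}
    (hy : ∀ s : ℝ, s • e + y ∈ B → ρ (s • e + y) ≠ 0) :
    ∫ t : ℝ, Ω.indicator (fun x => fderiv ℝ h x e) (t • e + y) = 0 := by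
  have hout : ∀ t : ℝ, t • e + y ∉ B → fderiv ℝ h (t • e + y) e = 0 := fun t ht => by
    rw [fderiv_of_notMem_tsupport ℝ fun hx => ht (hB hx)]
    rfl
  set I : Set ℝ := {t | t • e + y ∈ B} with hI
  have hIc : Convex ℝ I := by
    intro a ha b hb p q hp hq hpq
    have : (p • a + q • b) • e + y = p • (a • e + y) + q • (b • e + y) := by
      have : y = (p + q) • y := by rw [hpq, one_smul]
      nth_rewrite 1 [this]
      simp only [smul_add, add_smul, smul_smul, smul_eq_mul]
      abel
    simp only [hI, Set.mem_ofPred_eq, this]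
    exact hBc ha hb hp hq hpq
  have hcont : ContinuousOn (fun t : ℝ => ρ (t • e + y)) I :=
    hρ.comp (isClosedEmbedding_smul_add he y).continuous.continuousOn fun t ht => ht
  by_cases hneg : ∃ a ∈ I, ρ (a • e + y) < 0
  · obtain ⟨a, haI, ha⟩ := hneg
    rw [← integral_fderiv_smul_add_eq_zero hh hc he y]
    refine integral_congr_ae (Eventually.of_forall fun t => ?_)
    by_cases ht : t • e + y ∈ B
    · have hmem : t • e + y ∈ Ω := by
        rw [hΩ _ ht]
        by_contra hge
        obtain ⟨s, hsI, hs⟩ := hIc.isPreconnected.intermediate_value haI ht hcont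
          ⟨ha.le, not_lt.1 hge⟩
        exact hy s hsI hs
      simp only [Set.indicator_of_mem hmem]
    · simp [hout t ht]
  · push Not at hneg
    refine (integral_congr_ae (Eventually.of_forall fun t => ?_)).trans (integral_zero ℝ ℂ)
    by_cases ht : t • e + y ∈ B
    · have hmem : t • e + y ∉ Ω := by
        rw [hΩ _ ht]
        exact not_lt.2 (hneg t ht)
      simp only [Set.indicator_of_notMem hmem]
    · simp [hout t ht]

end Transversal

/-! ### Comparison of measures -/

/-- The difference of the integrals is an integral against the positive measure `ν - μ`, and `ν ≤ c
μ` bounds the integral of `‖G‖` against it by `(c - 1) ∫ ‖G‖ dμ`. -/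
theorem MeasureTheory.Measure.norm_integral_sub_le {α : Type*} [MeasurableSpace α] {μ ν : Measure α}
    [IsFiniteMeasure μ] (hle : μ ≤ ν) {c : NNReal} (hc : 1 ≤ c) (hνc : ν ≤ c • μ) {G : α → ℂ}
    (hG : Integrable G ν) : ‖∫ x, G x ∂ν - ∫ x, G x ∂μ‖ ≤ (c - 1) * ∫ x, ‖G x‖ ∂ν := by
  have hν : ν = (ν - μ) + μ := (Measure.sub_add_cancel_of_le hle).symm
  have hGμ : Integrable G μ := hG.mono_measure hle
  have hGs : Integrable G (ν - μ) := hG.mono_measure Measure.sub_le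
  have h1 : ∫ x, G x ∂ν - ∫ x, G x ∂μ = ∫ x, G x ∂(ν - μ) := by
    nth_rewrite 1 [hν]
    rw [integral_add_measure hGs hGμ, add_sub_cancel_right]
  have h2 : ∫ x, ‖G x‖ ∂ν - ∫ x, ‖G x‖ ∂μ = ∫ x, ‖G x‖ ∂(ν - μ) := by
    nth_rewrite 1 [hν]
    rw [integral_add_measure hGs.norm hGμ.norm, add_sub_cancel_right]
  have h3 : ∫ x, ‖G x‖ ∂ν ≤ c * ∫ x, ‖G x‖ ∂μ := by
    have := integral_mono_measure hνc (Eventually.of_forall fun x => norm_nonneg (G x))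
      (hGμ.norm.smul_measure_nnreal (c := c))
    rwa [integral_smul_nnreal_measure] at this
  have h4 : ∫ x, ‖G x‖ ∂μ ≤ ∫ x, ‖G x‖ ∂ν :=
    integral_mono_measure hle (Eventually.of_forall fun x => norm_nonneg (G x)) hG.norm
  have h5 : (1 : ℝ) ≤ c := by exact_mod_cast hc
  rw [h1]
  refine (norm_integral_le_integral_norm _).trans ?_
  rw [← h2]
  nlinarith

/-! ### Hausdorff measure under a nearly isometric projection -/

section Projection

variable {X Y : Type*} [MetricSpace X] [MeasurableSpace X] [BorelSpace X]
  [MetricSpace Y] [MeasurableSpace Y] [BorelSpace Y] {π : X → Y} {M : Set X} {n : ℕ}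

theorem LipschitzOnWith.euclideanHausdorffMeasure_image_le {K : NNReal} (h : LipschitzOnWith K π M)
    (n : ℕ) : μHE[n] (π '' M) ≤ (K : ENNReal) ^ n * μHE[n] M := by
  have := h.hausdorffMeasure_image_le (d := n) (by positivity)
  rw [ENNReal.rpow_natCast] at this
  simp only [Measure.euclideanHausdorffMeasure_def, Measure.smul_apply, ENNReal.smul_def,
    smul_eq_mul]
  calc _ ≤ _ := mul_le_mul_right this _
    _ = _ := by ring

theorem restrict_image_le_map_restrict (hπ : LipschitzWith 1 π) :
    (μHE[n] : Measure Y).restrict (π '' M) ≤ ((μHE[n] : Measure X).restrict M).map π := by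
  refine Measure.le_iff.2 fun S hS => ?_
  rw [Measure.map_apply hπ.continuous.measurable hS, Measure.restrict_apply hS,
    Measure.restrict_apply (hπ.continuous.measurable hS), Set.inter_comm,
    ← Set.image_inter_preimage, Set.inter_comm]
  simpa using (hπ.lipschitzOnWith (s := π ⁻¹' S ∩ M)).euclideanHausdorffMeasure_image_le n

/-- The hypothesis says that the inverse of `π` on `M` is `K`-Lipschitz, so passing back from the
image enlarges `n`-dimensional measure by at most `K^n`. -/
theorem map_restrict_le_smul_restrict_image (hπ : LipschitzWith 1 π)
    {K : NNReal} (hK : ∀ x ∈ M, ∀ y ∈ M, dist x y ≤ K * dist (π x) (π y)) :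
    ((μHE[n] : Measure X).restrict M).map π ≤ (K ^ n) • (μHE[n] : Measure Y).restrict (π '' M) := by
  refine Measure.le_iff.2 fun S hS => ?_
  rw [Measure.map_apply hπ.continuous.measurable hS, Measure.smul_apply, Measure.restrict_apply hS,
    Measure.restrict_apply (hπ.continuous.measurable hS), Set.inter_comm S,
    ← Set.image_inter_preimage, Set.inter_comm M]
  set A := π ⁻¹' S ∩ M
  rcases A.eq_empty_or_nonempty with hA | ⟨a, ha⟩
  · simp [hA]
  have : Nonempty X := ⟨a⟩
  have hinj : Set.InjOn π A := fun x hx y hy hxy => by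
    have := hK x hx.2 y hy.2
    rw [hxy, dist_self, mul_zero] at this
    exact dist_le_zero.1 this
  have hL : LipschitzOnWith K (Function.invFunOn π A) (π '' A) := by
    refine LipschitzOnWith.of_dist_le_mul ?_
    rintro _ ⟨x, hx, rfl⟩ _ ⟨y, hy, rfl⟩
    rw [hinj.leftInvOn_invFunOn hx, hinj.leftInvOn_invFunOn hy]
    exact hK x hx.2 y hy.2
  have := hL.euclideanHausdorffMeasure_image_le n
  rw [hinj.leftInvOn_invFunOn.image_image] at this
  simpa [ENNReal.smul_def] using this

/-- If `G` on `Y` lifts to `h` on `M` under an almost isometric projection, then the integrals of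
`G` and `h` almost agree. -/
theorem norm_setIntegral_sub_integral_le [CompleteSpace X] [SecondCountableTopology X]
    (hπ : LipschitzWith 1 π) (hM : MeasurableSet M) (hMfin : μHE[n] M ≠ ⊤)
    {K : NNReal} (hK1 : 1 ≤ K) (hK : ∀ x ∈ M, ∀ y ∈ M, dist x y ≤ K * dist (π x) (π y))
    {G : Y → ℂ} {h : X → ℂ} (hG : AEStronglyMeasurable G (μHE[n] : Measure Y))
    (hGh : ∀ x ∈ M, G (π x) = h x) (hG0 : ∀ y, y ∉ π '' M → G y = 0)
    (hh : IntegrableOn h M μHE[n]) :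
    ‖∫ x in M, h x ∂μHE[n] - ∫ y, G y ∂μHE[n]‖ ≤
      ((K : ℝ) ^ n - 1) * ∫ x in M, ‖h x‖ ∂μHE[n] := by
  have hinj : Set.InjOn π M := fun x hx y hy hxy => by
    have := hK x hx y hy
    rw [hxy, dist_self, mul_zero] at this
    exact dist_le_zero.1 this
  -- Lusin–Souslin: an injective continuous image of a Borel set in a Polish space is Borel.
  have hπM : MeasurableSet (π '' M) := hM.image_of_continuousOn_injOn hπ.continuous.continuousOn hinj
  set μ := (μHE[n] : Measure Y).restrict (π '' M) with hμ
  set ν := ((μHE[n] : Measure X).restrict M).map π with hν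
  have hle : μ ≤ ν := restrict_image_le_map_restrict hπ
  have hνc : ν ≤ (K ^ n) • μ := map_restrict_le_smul_restrict_image hπ hK
  have hνfin : IsFiniteMeasure ν := by
    refine ⟨?_⟩
    rw [hν, Measure.map_apply hπ.continuous.measurable MeasurableSet.univ]
    simpa using hMfin.lt_top
  have hμfin : IsFiniteMeasure μ := isFiniteMeasure_of_le ν hle
  have hGν : AEStronglyMeasurable G ν := by
    have h1 : AEStronglyMeasurable G μ := hG.restrict
    exact (h1.smul_measure (K ^ n)).mono_measure hνc
  have hae : (fun x => G (π x)) =ᵐ[(μHE[n] : Measure X).restrict M] h :=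
    (ae_restrict_iff' hM).2 (Eventually.of_forall hGh)
  have hGi : Integrable G ν :=
    (integrable_map_measure hGν hπ.continuous.aemeasurable).2 (hh.congr hae.symm)
  have e1 : ∫ y, G y ∂ν = ∫ x in M, h x ∂μHE[n] := by
    rw [hν, integral_map hπ.continuous.aemeasurable hGν]
    exact integral_congr_ae hae
  have e2 : ∫ y, ‖G y‖ ∂ν = ∫ x in M, ‖h x‖ ∂μHE[n] := by
    rw [hν, integral_map hπ.continuous.aemeasurable hGν.norm]
    exact integral_congr_ae (hae.fun_comp norm)
  have e3 : ∫ y, G y ∂μ = ∫ y, G y ∂μHE[n] :=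
    setIntegral_eq_integral_of_forall_compl_eq_zero hG0
  have := Measure.norm_integral_sub_le hle (one_le_pow₀ hK1) hνc hGi
  rw [e1, e2, e3] at this
  simpa using this

end Projection

/-! ### The regular boundary -/

section RegularBoundary

variable {d : ℕ} {Ω : Set (EuclideanSpace ℝ (Fin d))} {p : EuclideanSpace ℝ (Fin d)}

theorem IsUnitOutwardNormal.outwardNormal_eq {v : EuclideanSpace ℝ (Fin d)}
    (hv : IsUnitOutwardNormal Ω p v) : outwardNormal Ω p = v := by
  have h : ∃ v, IsUnitOutwardNormal Ω p v := ⟨v, hv⟩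
  rw [outwardNormal, dif_pos h]
  exact h.choose_spec.unique hv

theorem IsUnitOutwardNormal.norm_eq_one {v : EuclideanSpace ℝ (Fin d)}
    (hv : IsUnitOutwardNormal Ω p v) : ‖v‖ = 1 := by
  obtain ⟨ρ, -, -, hg, -, rfl⟩ := hv
  rw [norm_smul, norm_inv, norm_norm, inv_mul_cancel₀ (norm_ne_zero_iff.2 hg)]

theorem norm_outwardNormal_of_mem (hp : p ∈ regularBoundary Ω) : ‖outwardNormal Ω p‖ = 1 := by
  obtain ⟨-, v, hv⟩ := hp
  rw [hv.outwardNormal_eq, hv.norm_eq_one]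

theorem norm_outwardNormal_le (Ω : Set (EuclideanSpace ℝ (Fin d))) (p : EuclideanSpace ℝ (Fin d)) :
    ‖outwardNormal Ω p‖ ≤ 1 := by
  by_cases h : ∃ v, IsUnitOutwardNormal Ω p v
  · obtain ⟨v, hv⟩ := h
    rw [hv.outwardNormal_eq, hv.norm_eq_one]
  · rw [outwardNormal, dif_neg h, norm_zero]
    exact zero_le_one

theorem inner_gradient_eq_fderiv (ρ : EuclideanSpace ℝ (Fin d) → ℝ) (x v : EuclideanSpace ℝ (Fin d)) :
    inner ℝ (∇ ρ x) v = fderiv ℝ ρ x v := by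
  rw [gradient, InnerProductSpace.toDual_symm_apply]

theorem ContDiffAt.continuousAt_gradient {ρ : EuclideanSpace ℝ (Fin d) → ℝ}
    (h : ContDiffAt ℝ 1 ρ p) : ContinuousAt (∇ ρ) p :=
  (InnerProductSpace.toDual ℝ _).symm.continuous.continuousAt.comp
    (h.fderiv_right (m := 0) (by norm_num)).continuousAt

/-- Near a regular boundary point, `Ω` is the sublevel set of a function that is almost affine,
and the boundary consists of regular points with almost constant normal. -/
theorem exists_ball_defining (hΩ : IsOpen Ω) (hp : p ∈ regularBoundary Ω) {η : ℝ} (hη : 0 < η)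
    (hη1 : η < 1) : ∃ (ρ : EuclideanSpace ℝ (Fin d) → ℝ) (c r : ℝ), 0 < c ∧ 0 < r ∧
      (∀ x ∈ Metric.ball p r, (x ∈ Ω ↔ ρ x < 0)) ∧ ContinuousOn ρ (Metric.ball p r) ∧
      (∀ x ∈ Metric.ball p r, ∀ y ∈ Metric.ball p r,
        |ρ x - ρ y - c * inner ℝ (outwardNormal Ω p) (x - y)| ≤ c * η * ‖x - y‖) ∧
      (∀ x ∈ Metric.ball p r, (x ∈ frontier Ω ↔ ρ x = 0)) ∧
      (∀ x ∈ Metric.ball p r, x ∈ frontier Ω →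
        x ∈ regularBoundary Ω ∧ ‖outwardNormal Ω x - outwardNormal Ω p‖ ≤ η) := by
  obtain ⟨-, v, hv⟩ := hp
  have hnv := hv.norm_eq_one
  rw [hv.outwardNormal_eq]
  obtain ⟨ρ, hρ, hρ0, hg, hloc, rfl⟩ := hv
  have hc : 0 < ‖∇ ρ p‖ := norm_pos_iff.2 hg
  set c := ‖∇ ρ p‖
  set v := c⁻¹ • ∇ ρ p with hvdef
  have hvg : ∇ ρ p = c • v := by rw [hvdef, smul_smul, mul_inv_cancel₀ hc.ne', one_smul]
  -- Strict differentiability compares `ρ` at two arbitrary nearby points with the one linear form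
  -- at `p`. The tolerance is scaled by `c = ‖∇ρ p‖` to make the estimate relative.
  obtain ⟨s, hs, hlin⟩ := (hρ.hasStrictFDerivAt one_ne_zero).approximates_deriv_on_nhds
    (c := ⟨c * η, by positivity⟩) (Or.inr (show 0 < c * η by positivity))
  have hgc := hρ.continuousAt_gradient
  have hnc : ContinuousAt (fun x => ‖∇ ρ x‖⁻¹ • ∇ ρ x) p :=
    (hgc.norm.inv₀ hc.ne').smul hgc
  have hev : ∀ᶠ x in 𝓝 p, (∀ᶠ y in 𝓝 x, y ∈ Ω ↔ ρ y < 0) ∧ ContDiffAt ℝ 1 ρ x ∧ x ∈ s ∧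
      ∇ ρ x ≠ 0 ∧ ‖‖∇ ρ x‖⁻¹ • ∇ ρ x - v‖ < η := by
    refine (eventually_eventually_nhds.2 hloc).and ((hρ.eventually (by simp)).and
      ((show ∀ᶠ x in 𝓝 p, x ∈ s from hs).and ((hgc.eventually_ne hg).and ?_)))
    have := hnc.eventually (Metric.ball_mem_nhds _ hη)
    filter_upwards [this] with x hx
    rwa [dist_eq_norm] at hx
  obtain ⟨r, hr, hball⟩ := Metric.eventually_nhds_iff_ball.1 hev
  have happrox : ∀ x ∈ Metric.ball p r, ∀ y ∈ Metric.ball p r,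
      |ρ x - ρ y - c * inner ℝ v (x - y)| ≤ c * η * ‖x - y‖ := by
    intro x hx y hy
    have : |ρ x - ρ y - fderiv ℝ ρ p (x - y)| ≤ c * η * ‖x - y‖ :=
      hlin x (hball x hx).2.2.1 y (hball y hy).2.2.1
    rwa [← inner_gradient_eq_fderiv, hvg, real_inner_smul_left] at this
  have hfr : ∀ x ∈ Metric.ball p r, (x ∈ frontier Ω ↔ ρ x = 0) := by
    intro x hx
    have hxΩ := (hball x hx).1.self_of_nhds
    rw [hΩ.frontier_eq]
    constructor
    · rintro ⟨hcl, hnot⟩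
      refine le_antisymm ?_ (not_lt.1 (mt hxΩ.2 hnot))
      by_contra hpos
      have h1 : ∀ᶠ y in 𝓝 x, 0 < ρ y :=
        (hball x hx).2.1.continuousAt.eventually_const_lt (not_le.1 hpos)
      obtain ⟨y, hy, hy1, hy2⟩ :=
        (mem_closure_iff_frequently.1 hcl).and_eventually (h1.and (hball x hx).1) |>.exists
      exact lt_asymm hy1 (hy2.1 hy)
    · intro h0
      refine ⟨?_, fun h => (hxΩ.1 h).ne h0⟩
      -- From a zero of `ρ`, moving by `t` against the normal gives `ρ ≤ -c t (1 - η) < 0`, so the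
      -- zero is a limit of points of `Ω`. Here `η < 1` enters.
      have hline : Tendsto (fun t : ℝ => x - t • v) (𝓝[>] 0) (𝓝 x) := by
        have : Tendsto (fun t : ℝ => x - t • v) (𝓝 0) (𝓝 (x - (0 : ℝ) • v)) :=
          (Continuous.tendsto (by fun_prop) 0)
        rw [zero_smul, sub_zero] at this
        exact this.mono_left nhdsWithin_le_nhds
      refine mem_closure_of_tendsto hline ?_
      filter_upwards [hline.eventually (Metric.isOpen_ball.mem_nhds hx),
        self_mem_nhdsWithin] with t ht (ht0 : 0 < t)
      rw [(hball _ ht).1.self_of_nhds]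
      have h1 := (abs_le.1 (happrox _ ht x hx)).2
      have e : x - t • v - x = -(t • v) := by abel
      rw [e, h0, inner_neg_right, real_inner_smul_right, real_inner_self_eq_norm_sq, hnv,
        norm_neg, norm_smul, hnv, Real.norm_of_nonneg ht0.le] at h1
      have h2 : 0 < c * t := mul_pos hc ht0
      nlinarith
  refine ⟨ρ, c, r, hc, hr, fun x hx => (hball x hx).1.self_of_nhds,
    fun x hx => (hball x hx).2.1.continuousAt.continuousWithinAt, happrox, hfr, fun x hx hxf => ?_⟩
  have hxn : IsUnitOutwardNormal Ω x (‖∇ ρ x‖⁻¹ • ∇ ρ x) :=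
    ⟨ρ, (hball x hx).2.1, (hfr x hx).1 hxf, (hball x hx).2.2.2.1, (hball x hx).1, rfl⟩
  refine ⟨⟨hxf, _, hxn⟩, ?_⟩
  rw [hxn.outwardNormal_eq]
  exact (hball x hx).2.2.2.2.le

theorem continuousOn_outwardNormal (hΩ : IsOpen Ω) :
    ContinuousOn (outwardNormal Ω) (regularBoundary Ω) := by
  intro p hp
  refine Metric.continuousWithinAt_iff'.2 fun ε hε => ?_
  obtain ⟨ρ, c, r, -, hr, -, -, -, -, h⟩ := exists_ball_defining hΩ hp
    (η := min (ε / 2) (1 / 2)) (by positivity) (lt_of_le_of_lt (min_le_right _ _) (by norm_num))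
  filter_upwards [mem_nhdsWithin_of_mem_nhds (Metric.ball_mem_nhds p hr), self_mem_nhdsWithin]
    with x hx hxr
  rw [dist_eq_norm]
  calc _ ≤ min (ε / 2) (1 / 2) := (h x hx hxr.1).2
    _ ≤ ε / 2 := min_le_left _ _
    _ < ε := by linarith

/-- Regularity is an open condition along the frontier. For bounded `Ω` the singular set is thus
compact, which later allows a finite cover. -/
theorem isClosed_frontier_diff_regularBoundary (hΩ : IsOpen Ω) :
    IsClosed (frontier Ω \ regularBoundary Ω) := by
  rw [← isOpen_compl_iff, isOpen_iff_mem_nhds]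
  intro p hp
  by_cases hpf : p ∈ frontier Ω
  · have hpr : p ∈ regularBoundary Ω := by
      by_contra h
      exact hp ⟨hpf, h⟩
    obtain ⟨ρ, c, r, -, hr, -, -, -, -, h⟩ := exists_ball_defining hΩ hpr
      (η := 1 / 2) (by norm_num) (by norm_num)
    filter_upwards [Metric.ball_mem_nhds p hr] with x hx hxS
    exact hxS.2 (h x hx hxS.1).1
  · filter_upwards [isClosed_frontier.isOpen_compl.mem_nhds hpf] with x hx hxS
    exact hx hxS.1

theorem measurableSet_regularBoundary (hΩ : IsOpen Ω) : MeasurableSet (regularBoundary Ω) := by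
  have e : regularBoundary Ω = frontier Ω \ (frontier Ω \ regularBoundary Ω) := by
    rw [Set.sdiff_sdiff_cancel_left]
    exact fun x hx => hx.1
  rw [e]
  exact isClosed_frontier.measurableSet.diff
    (isClosed_frontier_diff_regularBoundary hΩ).measurableSet

theorem IsPiecewiseC1Region.aestronglyMeasurable_outwardNormal (hΩ : IsPiecewiseC1Region Ω) :
    AEStronglyMeasurable (outwardNormal Ω) (μHE[d - 1].restrict (frontier Ω)) := by
  have h1 : AEStronglyMeasurable (outwardNormal Ω) (μHE[d - 1].restrict (regularBoundary Ω)) :=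
    (continuousOn_outwardNormal hΩ.isOpen).aestronglyMeasurable
      (measurableSet_regularBoundary hΩ.isOpen)
  have h2 : regularBoundary Ω =ᵐ[μHE[d - 1]] frontier Ω := by
    refine Filter.EventuallyLE.antisymm (Eventually.of_forall fun x hx => hx.1) ?_
    exact ae_le_set.2 hΩ.area_singular
  rwa [Measure.restrict_congr_set h2] at h1

end RegularBoundary

/-! ### The defect in the divergence theorem -/

section Defect

variable {d : ℕ} {Ω : Set (EuclideanSpace ℝ (Fin d))} {h : EuclideanSpace ℝ (Fin d) → ℂ}

/-- The difference of the two sides of `∫_Ω ∂_v h dV = ∫_∂Ω h v·n dS`. -/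
noncomputable def divergenceDefect (Ω : Set (EuclideanSpace ℝ (Fin d)))
    (h : EuclideanSpace ℝ (Fin d) → ℂ) (v : EuclideanSpace ℝ (Fin d)) : ℂ :=
  (∫ x in Ω, fderiv ℝ h x v) -
    ∫ x in frontier Ω, ((inner ℝ v (outwardNormal Ω x) : ℝ) : ℂ) * h x ∂μHE[d - 1]

theorem IsPiecewiseC1Region.isCompact_frontier (hΩ : IsPiecewiseC1Region Ω) :
    IsCompact (frontier Ω) :=
  hΩ.isBounded.isCompact_closure.of_isClosed_subset isClosed_frontier frontier_subset_closure

theorem IsPiecewiseC1Region.integrableOn_frontier (hΩ : IsPiecewiseC1Region Ω)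
    (hh : ContinuousOn h (frontier Ω)) : IntegrableOn h (frontier Ω) μHE[d - 1] := by
  obtain ⟨C, hC⟩ := hΩ.isCompact_frontier.exists_bound_of_continuousOn hh
  exact IntegrableOn.of_bound hΩ.area_lt_top
    (hh.aestronglyMeasurable isClosed_frontier.measurableSet) C
    ((ae_restrict_iff' isClosed_frontier.measurableSet).2 (Eventually.of_forall hC))

theorem IsPiecewiseC1Region.integrableOn_frontier_inner_mul (hΩ : IsPiecewiseC1Region Ω)
    (hh : ContinuousOn h (frontier Ω)) (v : EuclideanSpace ℝ (Fin d)) :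
    IntegrableOn (fun x => ((inner ℝ v (outwardNormal Ω x) : ℝ) : ℂ) * h x) (frontier Ω)
      μHE[d - 1] := by
  refine (hΩ.integrableOn_frontier hh).bdd_mul (c := ‖v‖) ?_ (Eventually.of_forall fun x => ?_)
  · exact Complex.continuous_ofReal.comp_aestronglyMeasurable
      (hΩ.aestronglyMeasurable_outwardNormal.const_inner)
  · rw [Complex.norm_real]
    refine (norm_inner_le_norm _ _).trans ?_
    exact mul_le_of_le_one_right (norm_nonneg _) (norm_outwardNormal_le _ _)

theorem divergenceDefect_add (hΩ : IsPiecewiseC1Region Ω) (hh : ContDiff ℝ 1 h)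
    (hc : HasCompactSupport h) (v w : EuclideanSpace ℝ (Fin d)) :
    divergenceDefect Ω h (v + w) = divergenceDefect Ω h v + divergenceDefect Ω h w := by
  have h1 := (integrable_fderiv_apply hh hc v).integrableOn (s := Ω)
  have h2 := (integrable_fderiv_apply hh hc w).integrableOn (s := Ω)
  have h3 := hΩ.integrableOn_frontier_inner_mul hh.continuous.continuousOn v
  have h4 := hΩ.integrableOn_frontier_inner_mul hh.continuous.continuousOn w
  simp only [divergenceDefect, map_add, inner_add_left, Complex.ofReal_add, add_mul]
  rw [integral_add h1 h2, integral_add h3 h4]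
  ring

theorem divergenceDefect_smul (a : ℝ) (v : EuclideanSpace ℝ (Fin d)) :
    divergenceDefect Ω h (a • v) = a * divergenceDefect Ω h v := by
  simp only [divergenceDefect, map_smul, inner_smul_left, Complex.ofReal_mul, Complex.real_smul,
    mul_assoc, integral_const_mul]
  simp
  ring

theorem divergenceDefect_sum (hΩ : IsPiecewiseC1Region Ω) {ι : Type*} (s : Finset ι)
    {f : ι → EuclideanSpace ℝ (Fin d) → ℂ} (hf : ∀ i ∈ s, ContDiff ℝ 1 (f i))
    (hc : ∀ i ∈ s, HasCompactSupport (f i)) (v : EuclideanSpace ℝ (Fin d)) :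
    divergenceDefect Ω (fun x => ∑ i ∈ s, f i x) v = ∑ i ∈ s, divergenceDefect Ω (f i) v := by
  have h1 : ∀ x, fderiv ℝ (fun x => ∑ i ∈ s, f i x) x v = ∑ i ∈ s, fderiv ℝ (f i) x v := by
    intro x
    rw [fderiv_fun_sum fun i hi => (hf i hi).differentiable one_ne_zero x]
    simp
  simp only [divergenceDefect, h1, Finset.mul_sum]
  rw [integral_finsetSum, integral_finsetSum, Finset.sum_sub_distrib]
  · exact fun i hi => hΩ.integrableOn_frontier_inner_mul (hf i hi).continuous.continuousOn v
  · exact fun i hi => (integrable_fderiv_apply (hf i hi) (hc i hi) v).integrableOn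

end Defect

/-! ### The divergence theorem near a regular point, with small relative error -/

section LocalEstimate

variable {d : ℕ} {Ω : Set (EuclideanSpace ℝ (Fin d))} {p : EuclideanSpace ℝ (Fin d)}

/-- Unit vectors at distance `O(η)` have inner product `1 - O(η²)`: this second-order gain is what
survives the later division by `η`. -/
theorem one_sub_inner_eq {V : Type*} [NormedAddCommGroup V] [InnerProductSpace ℝ V] {a b : V}
    (ha : ‖a‖ = 1) (hb : ‖b‖ = 1) : 1 - inner ℝ a b = ‖a - b‖ ^ 2 / 2 := by
  rw [norm_sub_sq_real, ha, hb]
  ring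

theorem euclideanHausdorffMeasure_orthogonal_eq_volume {e : EuclideanSpace ℝ (Fin d)}
    (he : ‖e‖ = 1) : (μHE[d - 1] : Measure (ℝ ∙ e)ᗮ) = volume := by
  have h1 : Module.finrank ℝ (ℝ ∙ e)ᗮ = d - 1 := by
    have h2 := (ℝ ∙ e).finrank_add_finrank_orthogonal
    rw [finrank_span_singleton (by rintro rfl; simp at he), finrank_euclideanSpace_fin] at h2
    omega
  rw [← h1, InnerProductSpace.euclideanHausdorffMeasure_eq_volume]

/-- The divergence theorem near a regular boundary point up to a small relative error, in a
direction close to the normal. -/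
theorem exists_ball_norm_divergenceDefect_le (hΩ : IsPiecewiseC1Region Ω)
    (hp : p ∈ regularBoundary Ω) {η : ℝ} (hη : 0 < η) (hη1 : η ≤ 1 / 8) :
    ∃ r > 0, ∀ h : EuclideanSpace ℝ (Fin d) → ℂ, ContDiff ℝ 1 h → HasCompactSupport h →
      tsupport h ⊆ Metric.ball p r → ∀ e : EuclideanSpace ℝ (Fin d), ‖e‖ = 1 →
      ‖e - outwardNormal Ω p‖ ≤ 2 * η →
      ‖divergenceDefect Ω h e‖ ≤ (((1 + 9 * η ^ 2) ^ (d - 1) - 1) + 9 / 2 * η ^ 2) *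
        ∫ x in frontier Ω, ‖h x‖ ∂μHE[d - 1] := by
  obtain ⟨ρ, c, r, hc, hr, hρΩ, hρc, hρ, hρf, hreg⟩ :=
    exists_ball_defining hΩ.isOpen hp hη (by linarith)
  refine ⟨r, hr, fun h hh hhc hB e he hen => ?_⟩
  set B := Metric.ball p r with hBdef
  set n := outwardNormal Ω p with hn
  have hn1 : ‖n‖ = 1 := norm_outwardNormal_of_mem hp
  set M := frontier Ω ∩ B with hMdef
  have hMm : MeasurableSet M := isClosed_frontier.measurableSet.inter Metric.isOpen_ball.measurableSet
  have hh0 : ∀ x, x ∉ B → h x = 0 := fun x hx => image_eq_zero_of_notMem_tsupport fun h' => hx (hB h')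
  set π := (ℝ ∙ e)ᗮ.orthogonalProjectionOnto with hπdef
  have hπ : LipschitzWith 1 π := by
    refine π.lipschitz.weaken ?_
    exact_mod_cast Submodule.orthogonalProjectionOnto_norm_le _
  have hMfin : μHE[d - 1] M ≠ ⊤ :=
    ((measure_mono Set.inter_subset_left).trans_lt hΩ.area_lt_top).ne
  have hmono : ∀ x ∈ B, ∀ t : ℝ, 0 < t → x + t • e ∈ B → ρ x < ρ (x + t • e) := by
    intro x hx t ht hxt
    have h1 := (abs_le.1 (hρ _ hxt x hx)).1
    have h2 := one_sub_inner_eq hn1 he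
    rw [norm_sub_rev] at h2
    rw [add_sub_cancel_left, real_inner_smul_right, norm_smul, he, Real.norm_of_nonneg ht.le,
      mul_one] at h1
    have h3 : ‖e - n‖ ^ 2 ≤ (2 * η) ^ 2 := by gcongr
    -- As `⟨n, e⟩ ≥ 1 - 2η²` and `η ≤ 1/8`, the linear growth of `ρ` along `e` exceeds its error `c
    -- η t`.
    have h4 : η < inner ℝ n e := by nlinarith
    have h5 : 0 < c * t := mul_pos hc ht
    nlinarith
  -- On `M` the function `ρ` is 0, so chords are nearly tangential: `|⟨n, x - y⟩| ≤ η ‖x - y‖`,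
  -- hence `|⟨e, x - y⟩| ≤ 3η ‖x - y‖`. Projection keeps at least the fraction `1 - 9η²` of the
  -- squared length, and `(1 + a)² (1 - a) ≥ 1` for `a = 9η² ≤ 9/64`.
  set K : NNReal := ⟨1 + 9 * η ^ 2, by positivity⟩ with hK
  have hKdist : ∀ x ∈ M, ∀ y ∈ M, dist x y ≤ K * dist (π x) (π y) := by
    intro x hx y hy
    have h1 := hρ x hx.2 y hy.2
    rw [(hρf x hx.2).1 hx.1, (hρf y hy.2).1 hy.1, sub_zero, zero_sub, abs_neg, abs_mul,
      abs_of_pos hc, mul_assoc] at h1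
    have h2 : |inner ℝ n (x - y)| ≤ η * ‖x - y‖ := le_of_mul_le_mul_left h1 hc
    have h3 : |inner ℝ e (x - y)| ≤ 3 * η * ‖x - y‖ := by
      have e1 : inner ℝ e (x - y) = inner ℝ n (x - y) + inner ℝ (e - n) (x - y) := by
        rw [inner_sub_left]; ring
      rw [e1]
      calc _ ≤ |inner ℝ n (x - y)| + |inner ℝ (e - n) (x - y)| := abs_add_le _ _
        _ ≤ η * ‖x - y‖ + 2 * η * ‖x - y‖ := by
            gcongr
            exact (abs_real_inner_le_norm _ _).trans (by gcongr)
        _ = _ := by ring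
    have h4 := norm_sq_eq_inner_sq_add_norm_orthogonalProjectionOnto_sq he (x - y)
    have h5 : inner ℝ e (x - y) ^ 2 ≤ (3 * η * ‖x - y‖) ^ 2 := sq_le_sq' (abs_le.1 h3).1 (abs_le.1 h3).2
    rw [dist_eq_norm, dist_eq_norm, ← map_sub]
    refine abs_le_of_sq_le_sq' ?_ (by positivity) |>.2
    rw [mul_pow, hK]
    change _ ≤ (1 + 9 * η ^ 2) ^ 2 * _
    have h6 : (1 - 9 * η ^ 2) * ‖x - y‖ ^ 2 ≤ ‖π (x - y)‖ ^ 2 := by nlinarith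
    have h7 : 1 ≤ (1 + 9 * η ^ 2) ^ 2 * (1 - 9 * η ^ 2) := by
      have h8 : 9 * η ^ 2 ≤ 9 / 64 := by nlinarith
      have h9 : 0 ≤ 9 * η ^ 2 := by positivity
      set a := 9 * η ^ 2
      nlinarith [mul_nonneg h9 h9, mul_nonneg h9 (sub_nonneg.2 h8)]
    calc ‖x - y‖ ^ 2 ≤ ((1 + 9 * η ^ 2) ^ 2 * (1 - 9 * η ^ 2)) * ‖x - y‖ ^ 2 :=
          le_mul_of_one_le_left (by positivity) h7
      _ = (1 + 9 * η ^ 2) ^ 2 * ((1 - 9 * η ^ 2) * ‖x - y‖ ^ 2) := by ring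
      _ ≤ _ := by gcongr
  -- `G` integrates `∂_e h` over the part of each line in `Ω`. By the two slicing lemmas it is `h`
  -- at the boundary point above, and 0 where there is none.
  set G : (ℝ ∙ e)ᗮ → ℂ := fun y =>
    ∫ t : ℝ, Ω.indicator (fun x => fderiv ℝ h x e) (t • e + (y : EuclideanSpace ℝ (Fin d))) with hG
  have hFint : Integrable (Ω.indicator fun x => fderiv ℝ h x e) :=
    (integrable_fderiv_apply hh hhc e).indicator hΩ.isOpen.measurableSet
  have hGm : AEStronglyMeasurable G (μHE[d - 1] : Measure (ℝ ∙ e)ᗮ) := by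
    rw [euclideanHausdorffMeasure_orthogonal_eq_volume he]
    exact (integrable_integral_smul_add he hFint).aestronglyMeasurable
  have hGh : ∀ x ∈ M, G (π x) = h x := by
    intro x hx
    have hx' := inner_smul_add_orthogonalProjectionOnto he x
    have := integral_indicator_fderiv_eq_of_zero hh hhc hB he hρΩ hmono (s := inner ℝ e x)
      (y := (π x : EuclideanSpace ℝ (Fin d))) (by rw [hx']; exact hx.2)
      (by rw [hx']; exact (hρf x hx.2).1 hx.1)
    rwa [hx'] at this
  have hG0 : ∀ y, y ∉ π '' M → G y = 0 := by
    intro y hy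
    refine integral_indicator_fderiv_eq_zero hh hhc hB he hρΩ (convex_ball p r) hρc fun s hs hs0 => ?_
    refine hy ⟨s • e + y, ⟨(hρf _ hs).2 hs0, hs⟩, ?_⟩
    have e1 : π e = 0 := by
      rw [hπdef, Submodule.orthogonalProjectionOnto_eq_zero_iff]
      exact Submodule.le_orthogonal_orthogonal _ (Submodule.mem_span_singleton_self e)
    rw [map_add, map_smul, e1, smul_zero, zero_add, hπdef,
      Submodule.orthogonalProjectionOnto_mem_subspace_eq_self]
  have hhM : IntegrableOn h M μHE[d - 1] :=
    (hΩ.integrableOn_frontier hh.continuous.continuousOn).mono_set Set.inter_subset_left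
  have hmain := norm_setIntegral_sub_integral_le hπ hMm hMfin
    (show (1 : NNReal) ≤ K from le_add_of_nonneg_right (a := (1 : ℝ)) (by positivity))
    hKdist hGm hGh hG0 hhM
  rw [euclideanHausdorffMeasure_orthogonal_eq_volume he, hG,
    ← integral_eq_integral_integral_smul_add he hFint,
    integral_indicator hΩ.isOpen.measurableSet] at hmain
  have hset : ∀ F : EuclideanSpace ℝ (Fin d) → ℂ, (∀ x, x ∉ B → F x = 0) →
      ∫ x in frontier Ω, F x ∂μHE[d - 1] = ∫ x in M, F x ∂μHE[d - 1] := fun F hF =>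
    (setIntegral_eq_of_subset_of_forall_sdiff_eq_zero isClosed_frontier.measurableSet
      Set.inter_subset_left fun x hx => hF x fun hxB => hx.2 ⟨hx.1, hxB⟩)
  have hsetR : ∫ x in frontier Ω, ‖h x‖ ∂μHE[d - 1] = ∫ x in M, ‖h x‖ ∂μHE[d - 1] :=
    (setIntegral_eq_of_subset_of_forall_sdiff_eq_zero isClosed_frontier.measurableSet
      Set.inter_subset_left fun x hx => by
        rw [hh0 x fun hxB => hx.2 ⟨hx.1, hxB⟩, norm_zero])
  have hinM : IntegrableOn (fun x => ((inner ℝ e (outwardNormal Ω x) : ℝ) : ℂ) * h x) M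
      μHE[d - 1] :=
    (hΩ.integrableOn_frontier_inner_mul hh.continuous.continuousOn e).mono_set Set.inter_subset_left
  -- Inserting the weight `⟨e, n(x)⟩` costs `‖e - n(x)‖² / 2 ≤ (3η)² / 2`.
  have hsecond : ‖∫ x in M, h x ∂μHE[d - 1] -
      ∫ x in M, ((inner ℝ e (outwardNormal Ω x) : ℝ) : ℂ) * h x ∂μHE[d - 1]‖ ≤
      9 / 2 * η ^ 2 * ∫ x in M, ‖h x‖ ∂μHE[d - 1] := by
    rw [← integral_sub hhM hinM, ← integral_const_mul]
    refine norm_integral_le_of_norm_le (hhM.norm.const_mul _)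
      ((ae_restrict_iff' hMm).2 (Eventually.of_forall fun x hx => ?_))
    obtain ⟨hxr, hxn⟩ := hreg x hx.2 hx.1
    have h1 := one_sub_inner_eq he (norm_outwardNormal_of_mem hxr)
    have h2 : ‖e - outwardNormal Ω x‖ ≤ 3 * η := by
      calc ‖e - outwardNormal Ω x‖ = ‖(e - n) - (outwardNormal Ω x - n)‖ := by
            rw [sub_sub_sub_cancel_right]
        _ ≤ 2 * η + η := (norm_sub_le _ _).trans (add_le_add hen hxn)
        _ = 3 * η := by ring
    have e1 : h x - ((inner ℝ e (outwardNormal Ω x) : ℝ) : ℂ) * h x =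
        ((1 - inner ℝ e (outwardNormal Ω x) : ℝ) : ℂ) * h x := by
      push_cast; ring
    rw [e1, norm_mul, Complex.norm_real, h1, Real.norm_of_nonneg (by positivity)]
    gcongr
    have : ‖e - outwardNormal Ω x‖ ^ 2 ≤ (3 * η) ^ 2 := by gcongr
    linarith
  rw [divergenceDefect, hset _ fun x hx => by rw [hh0 x hx, mul_zero], hsetR]
  set I1 := ∫ x in Ω, fderiv ℝ h x e
  set I2 := ∫ x in M, h x ∂μHE[d - 1]
  set I3 := ∫ x in M, ((inner ℝ e (outwardNormal Ω x) : ℝ) : ℂ) * h x ∂μHE[d - 1]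
  have e2 : I1 - I3 = (I2 - I3) - (I2 - I1) := by ring
  rw [e2]
  refine (norm_sub_le _ _).trans ((add_le_add hsecond hmain).trans (le_of_eq ?_))
  rw [hK]
  change _ + ((1 + 9 * η ^ 2) ^ (d - 1) - 1) * _ = _
  ring

/-- The error has zero derivative at `η = 0`, so it is `o(η)`. The factor 3 is the cost of combining
two directions. -/
theorem eventually_pow_sub_one_add_le (m : ℕ) {δ : ℝ} (hδ : 0 < δ) :
    ∀ᶠ η : ℝ in 𝓝[>] 0, 3 * (((1 + 9 * η ^ 2) ^ m - 1) + 9 / 2 * η ^ 2) ≤ δ * η := by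
  have h1 : HasDerivAt (fun η : ℝ => 3 * (((1 + 9 * η ^ 2) ^ m - 1) + 9 / 2 * η ^ 2)) 0 0 := by
    have h2 : HasDerivAt (fun η : ℝ => η ^ 2) 0 0 := by
      simpa using hasDerivAt_pow 2 (0 : ℝ)
    have h3 := (((((h2.const_mul 9).const_add 1).pow m).sub_const 1).add
      (h2.const_mul (9 / 2))).const_mul 3
    convert! h3 using 1
    simp
  have h4 := hasDerivAt_iff_isLittleO.1 h1
  have h5 := (h4.bound hδ).filter_mono (nhdsWithin_le_nhds (s := Set.Ioi 0))
  filter_upwards [h5, self_mem_nhdsWithin] with η hη (hη0 : 0 < η)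
  simp only [sub_zero, smul_zero, Real.norm_eq_abs, abs_of_pos hη0] at hη
  have := (le_abs_self _).trans hη
  simpa using this

/-- The divergence theorem near a regular boundary point, up to an arbitrarily small relative
error. -/
theorem exists_ball_norm_divergenceDefect_le_mul (hΩ : IsPiecewiseC1Region Ω)
    (hp : p ∈ regularBoundary Ω) {δ : ℝ} (hδ : 0 < δ) {v : EuclideanSpace ℝ (Fin d)}
    (hv : ‖v‖ ≤ 1) :
    ∃ r > 0, ∀ h : EuclideanSpace ℝ (Fin d) → ℂ, ContDiff ℝ 1 h → HasCompactSupport h →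
      tsupport h ⊆ Metric.ball p r →
      ‖divergenceDefect Ω h v‖ ≤ δ * ∫ x in frontier Ω, ‖h x‖ ∂μHE[d - 1] := by
  have hsmall : ∀ᶠ η : ℝ in 𝓝[>] 0, η ≤ 1 / 8 :=
    nhdsWithin_le_nhds (Iic_mem_nhds (by norm_num))
  obtain ⟨η, hq, hη8, hη0⟩ := ((eventually_pow_sub_one_add_le (d - 1) hδ).and
    (hsmall.and self_mem_nhdsWithin)).exists
  replace hη0 : 0 < η := hη0
  obtain ⟨r, hr, hmain⟩ := exists_ball_norm_divergenceDefect_le hΩ hp hη0 hη8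
  refine ⟨r, hr, fun h hh hhc hB => ?_⟩
  set q := ((1 + 9 * η ^ 2) ^ (d - 1) - 1) + 9 / 2 * η ^ 2
  set I := ∫ x in frontier Ω, ‖h x‖ ∂μHE[d - 1]
  have hI : 0 ≤ I := integral_nonneg fun x => norm_nonneg _
  set n := outwardNormal Ω p
  have hn1 : ‖n‖ = 1 := norm_outwardNormal_of_mem hp
  -- Both `n` and the normalized `w` lie within `2η` of the normal, so both defects are at most `q
  -- I` with `q = o(η)`. By linearity `η` times the defect at `v` is the defect at `w` minus that at
  -- `n`; as `‖w‖ ≤ 2`, the total is `3 q I ≤ δ η I`.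
  set w := n + η • v
  have hwn : ‖w - n‖ ≤ η := by
    rw [add_sub_cancel_left, norm_smul, Real.norm_of_nonneg hη0.le]
    exact mul_le_of_le_one_right hη0.le hv
  have hw : |‖w‖ - 1| ≤ η := by
    have := abs_norm_sub_norm_le w n
    rw [hn1] at this
    exact this.trans hwn
  obtain ⟨hw1, hw2⟩ := abs_le.1 hw
  have hwpos : 0 < ‖w‖ := by linarith
  set e := ‖w‖⁻¹ • w
  have he : ‖e‖ = 1 := by rw [norm_smul, norm_inv, norm_norm, inv_mul_cancel₀ hwpos.ne']
  have hwe : w = ‖w‖ • e := by rw [smul_smul, mul_inv_cancel₀ hwpos.ne', one_smul]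
  have hen : ‖e - n‖ ≤ 2 * η := by
    have h1 : ‖e - w‖ ≤ η := by
      have : e - w = (1 - ‖w‖) • e := by
        rw [sub_smul, one_smul, ← hwe]
      rw [this, norm_smul, he, mul_one, Real.norm_eq_abs, abs_sub_comm]
      exact hw
    calc ‖e - n‖ = ‖(e - w) + (w - n)‖ := by rw [sub_add_sub_cancel]
      _ ≤ η + η := (norm_add_le _ _).trans (add_le_add h1 hwn)
      _ = 2 * η := by ring
  have h1 := hmain h hh hhc hB e he hen
  have h2 := hmain h hh hhc hB n hn1 (by rw [sub_self, norm_zero]; positivity)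
  have h3 : ‖divergenceDefect Ω h w‖ ≤ 2 * (q * I) := by
    rw [hwe, divergenceDefect_smul, norm_mul, Complex.norm_real, norm_norm]
    have : ‖w‖ ≤ 2 := by linarith
    gcongr
  have h4 : (η : ℂ) * divergenceDefect Ω h v = divergenceDefect Ω h w - divergenceDefect Ω h n := by
    rw [divergenceDefect_add hΩ hh hhc, divergenceDefect_smul]
    ring
  have h5 : η * ‖divergenceDefect Ω h v‖ ≤ 3 * q * I := by
    calc η * ‖divergenceDefect Ω h v‖ = ‖(η : ℂ) * divergenceDefect Ω h v‖ := by
          rw [norm_mul, Complex.norm_real, Real.norm_of_nonneg hη0.le]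
      _ ≤ 2 * (q * I) + q * I := by
          rw [h4]; exact (norm_sub_le _ _).trans (add_le_add h3 h2)
      _ = _ := by ring
  have h6 : 3 * q * I ≤ δ * η * I := mul_le_mul_of_nonneg_right hq hI
  refine le_of_mul_le_mul_left (h5.trans (h6.trans (le_of_eq ?_))) hη0
  ring

end LocalEstimate

/-! ### Localization -/

section Localization

variable {d : ℕ} {Ω : Set (EuclideanSpace ℝ (Fin d))} {h : EuclideanSpace ℝ (Fin d) → ℂ}

theorem divergenceDefect_eq_zero_of_subset (hh : ContDiff ℝ 1 h) (hc : HasCompactSupport h)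
    (hΩ : IsOpen Ω) (hs : tsupport h ⊆ Ω) (v : EuclideanSpace ℝ (Fin d)) :
    divergenceDefect Ω h v = 0 := by
  have h1 : ∫ x in Ω, fderiv ℝ h x v = 0 := by
    rw [setIntegral_eq_integral_of_forall_compl_eq_zero, integral_fderiv_apply_eq_zero hh hc]
    intro x hx
    rw [fderiv_of_notMem_tsupport ℝ fun h' => hx (hs h')]
    rfl
  have h2 : ∀ x ∈ frontier Ω, h x = 0 := fun x hx => image_eq_zero_of_notMem_tsupport fun h' => by
    rw [hΩ.frontier_eq] at hx
    exact hx.2 (hs h')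
  rw [divergenceDefect, h1, setIntegral_eq_zero_of_forall_eq_zero, sub_zero]
  intro x hx
  rw [h2 x hx, mul_zero]

theorem divergenceDefect_eq_zero_of_disjoint_closure
    (hs : Disjoint (tsupport h) (closure Ω)) (v : EuclideanSpace ℝ (Fin d)) :
    divergenceDefect Ω h v = 0 := by
  rw [divergenceDefect, setIntegral_eq_zero_of_forall_eq_zero,
    setIntegral_eq_zero_of_forall_eq_zero, sub_zero]
  · intro x hx
    rw [image_eq_zero_of_notMem_tsupport fun h' => hs.notMem_of_mem_left h'
      (frontier_subset_closure hx), mul_zero]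
  · intro x hx
    rw [fderiv_of_notMem_tsupport ℝ fun h' => hs.notMem_of_mem_left h' (subset_closure hx)]
    rfl

/-- Every point of the support has a neighbourhood with the estimate: in `Ω` and outside its closure
the defect is 0, and regular points were treated locally. A partition of unity glues these together.
-/
theorem norm_divergenceDefect_le_of_disjoint (hΩ : IsPiecewiseC1Region Ω) (hh : ContDiff ℝ 1 h)
    (hc : HasCompactSupport h) (hS : Disjoint (tsupport h) (frontier Ω \ regularBoundary Ω))
    {v : EuclideanSpace ℝ (Fin d)} (hv : ‖v‖ ≤ 1) {δ : ℝ} (hδ : 0 < δ) :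
    ‖divergenceDefect Ω h v‖ ≤ δ * ∫ x in frontier Ω, ‖h x‖ ∂μHE[d - 1] := by
  have hloc : ∀ q ∈ tsupport h, ∃ U : Set (EuclideanSpace ℝ (Fin d)), IsOpen U ∧ q ∈ U ∧
      ∀ h' : EuclideanSpace ℝ (Fin d) → ℂ, ContDiff ℝ 1 h' → HasCompactSupport h' →
      tsupport h' ⊆ U →
      ‖divergenceDefect Ω h' v‖ ≤ δ * ∫ x in frontier Ω, ‖h' x‖ ∂μHE[d - 1] := by
    intro q hq
    have hnn : ∀ h' : EuclideanSpace ℝ (Fin d) → ℂ,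
        0 ≤ δ * ∫ x in frontier Ω, ‖h' x‖ ∂μHE[d - 1] := fun h' =>
      mul_nonneg hδ.le (integral_nonneg fun x => norm_nonneg _)
    by_cases hqc : q ∈ closure Ω
    · by_cases hqΩ : q ∈ Ω
      · refine ⟨Ω, hΩ.isOpen, hqΩ, fun h' hh' hc' hs => ?_⟩
        rw [divergenceDefect_eq_zero_of_subset hh' hc' hΩ.isOpen hs, norm_zero]
        exact hnn h'
      · have hqf : q ∈ frontier Ω := by
          rw [hΩ.isOpen.frontier_eq]
          exact ⟨hqc, hqΩ⟩
        have hqr : q ∈ regularBoundary Ω := by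
          by_contra hn
          exact hS.notMem_of_mem_left hq ⟨hqf, hn⟩
        obtain ⟨r, hr, hU⟩ := exists_ball_norm_divergenceDefect_le_mul hΩ hqr hδ hv
        exact ⟨_, Metric.isOpen_ball, Metric.mem_ball_self hr, hU⟩
    · refine ⟨(closure Ω)ᶜ, isClosed_closure.isOpen_compl, hqc, fun h' hh' hc' hs => ?_⟩
      rw [divergenceDefect_eq_zero_of_disjoint_closure (Set.disjoint_left.2 fun x hx => hs hx),
        norm_zero]
      exact hnn h'
  choose! U hUo hUm hU using hloc
  obtain ⟨t, htK, ht⟩ := hc.isCompact.elim_nhds_subcover U fun q hq => (hUo q hq).mem_nhds (hUm q hq)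
  obtain ⟨f, hf⟩ := SmoothPartitionOfUnity.exists_isSubordinate
    (modelWithCornersSelf ℝ (EuclideanSpace ℝ (Fin d))) (isClosed_tsupport h)
    (fun i : t => U i) (fun i => hUo i (htK i i.2)) (by
      intro x hx
      obtain ⟨i, hi, hxi⟩ := Set.mem_iUnion₂.1 (ht hx)
      exact Set.mem_iUnion.2 ⟨⟨i, hi⟩, hxi⟩)
  set k : t → EuclideanSpace ℝ (Fin d) → ℂ := fun i x => ((f i x : ℝ) : ℂ) * h x with hk
  have hk1 : ∀ i, ContDiff ℝ 1 (k i) := fun i =>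
    (Complex.ofRealCLM.contDiff.comp ((f i).contMDiff.contDiff.of_le (by exact_mod_cast le_top))).mul hh
  have hkc : ∀ i, HasCompactSupport (k i) := fun i => hc.mul_left
  have hks : ∀ i, tsupport (k i) ⊆ U i := by
    intro i
    refine Set.Subset.trans (closure_mono fun x hx => ?_) (hf i)
    rw [Function.mem_support] at hx ⊢
    intro h0
    exact hx (by simp only [hk, h0, Complex.ofReal_zero, zero_mul])
  have hone : ∀ x ∈ tsupport h, ∑ i : t, f i x = 1 := by
    intro x hx
    rw [← finsum_eq_sum_of_fintype]
    exact f.sum_eq_one hx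
  have hsum : h = fun x => ∑ i : t, k i x := by
    funext x
    by_cases hx : x ∈ tsupport h
    · simp only [hk, ← Finset.sum_mul, ← Complex.ofReal_sum, hone x hx, Complex.ofReal_one, one_mul]
    · simp [hk, image_eq_zero_of_notMem_tsupport hx]
  -- The weights are nonnegative with sum 1, so the norms of the pieces add up exactly and the
  -- relative error `δ` does not grow with their number.
  have hnorm : ∀ x, ‖h x‖ = ∑ i : t, ‖k i x‖ := by
    intro x
    have e1 : ∀ i : t, ‖k i x‖ = f i x * ‖h x‖ := fun i => by
      simp only [hk]
      rw [norm_mul, Complex.norm_real, Real.norm_of_nonneg (f.nonneg i x)]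
    simp only [e1, ← Finset.sum_mul]
    by_cases hx : x ∈ tsupport h
    · rw [hone x hx, one_mul]
    · rw [image_eq_zero_of_notMem_tsupport hx, norm_zero, mul_zero]
  have hint : ∫ x in frontier Ω, ‖h x‖ ∂μHE[d - 1] =
      ∑ i : t, ∫ x in frontier Ω, ‖k i x‖ ∂μHE[d - 1] := by
    simp only [hnorm]
    exact integral_finsetSum _ fun i _ =>
      (hΩ.integrableOn_frontier (hk1 i).continuous.continuousOn).norm
  have hdef : divergenceDefect Ω h v = ∑ i : t, divergenceDefect Ω (k i) v := by
    rw [← divergenceDefect_sum hΩ _ (fun i _ => hk1 i) (fun i _ => hkc i), ← hsum]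
  rw [hdef, hint, Finset.mul_sum]
  exact (norm_sum_le _ _).trans
    (Finset.sum_le_sum fun i _ => hU i (htK i i.2) (k i) (hk1 i) (hkc i) (hks i))

theorem divergenceDefect_eq_zero_of_disjoint (hΩ : IsPiecewiseC1Region Ω) (hh : ContDiff ℝ 1 h)
    (hc : HasCompactSupport h) (hS : Disjoint (tsupport h) (frontier Ω \ regularBoundary Ω))
    (v : EuclideanSpace ℝ (Fin d)) : divergenceDefect Ω h v = 0 := by
  have key : ∀ w : EuclideanSpace ℝ (Fin d), ‖w‖ ≤ 1 → divergenceDefect Ω h w = 0 := by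
    intro w hw
    set I := ∫ x in frontier Ω, ‖h x‖ ∂μHE[d - 1]
    have hI : 0 ≤ I := integral_nonneg fun x => norm_nonneg _
    refine norm_le_zero_iff.1 (le_of_forall_pos_le_add fun ε hε => ?_)
    have h1 := norm_divergenceDefect_le_of_disjoint hΩ hh hc hS hw
      (δ := ε / (I + 1)) (by positivity)
    refine h1.trans ?_
    rw [zero_add, div_mul_eq_mul_div, div_le_iff₀ (by positivity)]
    nlinarith
  have e : v = (‖v‖ + 1) • ((‖v‖ + 1)⁻¹ • v) := by
    rw [smul_smul, mul_inv_cancel₀ (by positivity), one_smul]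
  rw [e, divergenceDefect_smul, key, mul_zero]
  rw [norm_smul, Real.norm_of_nonneg (by positivity), inv_mul_le_iff₀ (by positivity)]
  linarith

end Localization

/-! ### Removing a null set of codimension one -/

section Removal

theorem MeasureTheory.Measure.hausdorffMeasure_eq_zero_of_euclidean {X : Type*} [EMetricSpace X]
    [MeasurableSpace X] [BorelSpace X] {n : ℕ} {S : Set X} (h : μHE[n] S = 0) : μH[n] S = 0 := by
  rw [Measure.euclideanHausdorffMeasure_def, Measure.smul_apply, ENNReal.smul_def, smul_eq_mul,
    mul_eq_zero] at h
  refine h.resolve_left ?_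
  exact_mod_cast Measure.addHaarScalarFactor_volume_hausdorffMeasure_ne_zero n

/-- A compact null set for the `n`-dimensional Hausdorff measure is covered by finitely many balls
with small sum of the `n`-th powers of the radii. -/
theorem exists_finset_ball_cover {X : Type*} [MetricSpace X] [MeasurableSpace X] [BorelSpace X]
    [Nonempty X] {n : ℕ} {S : Set X} (hS : IsCompact S) (h0 : μHE[n] S = 0) {ε : ℝ} (hε : 0 < ε) :
    ∃ (F : Finset ℕ) (x : ℕ → X) (r : ℕ → ℝ), (∀ i, 0 < r i ∧ r i ≤ ε) ∧ (∀ i ∈ F, x i ∈ S) ∧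
      (S ⊆ ⋃ i ∈ F, Metric.ball (x i) (r i)) ∧ ∑ i ∈ F, r i ^ n ≤ ε := by
  have h0' := Measure.hausdorffMeasure_eq_zero_of_euclidean h0
  rcases S.eq_empty_or_nonempty with rfl | ⟨s₀, hs₀⟩
  · exact ⟨∅, fun _ => Classical.arbitrary X, fun _ => ε, fun _ => ⟨hε, le_rfl⟩, by simp, by simp,
      by simpa using hε.le⟩
  -- In dimension 0 a null set is empty. For `n ≠ 0` empty covering sets contribute `0^n = 0` rather
  -- than 1 to the sum of powers.
  have hn : n ≠ 0 := by
    rintro rfl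
    have := Measure.one_le_hausdorffMeasure_zero_of_nonempty (s := S) ⟨s₀, hs₀⟩
    rw [Nat.cast_zero] at h0'
    rw [h0'] at this
    simp at this
  rw [Measure.hausdorffMeasure_apply] at h0'
  have h1 := ENNReal.iSup_eq_zero.1 h0' (ENNReal.ofReal (ε / 2))
  rw [ENNReal.iSup_eq_zero] at h1
  have h2 := h1 (by positivity)
  have h3 : (0 : ENNReal) < ENNReal.ofReal (ε / 2) := by positivity
  rw [← h2] at h3
  simp only [iInf_lt_iff] at h3
  obtain ⟨t, hSt, htd, htsum⟩ := h3
  set D : ℕ → ℝ := fun i => (Metric.ediam (t i)).toReal with hD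
  have hfin : ∀ i, Metric.ediam (t i) ≠ ⊤ := fun i => ((htd i).trans_lt ENNReal.ofReal_lt_top).ne
  have hDle : ∀ i, D i ≤ ε / 2 := fun i => ENNReal.toReal_le_of_le_ofReal (by positivity) (htd i)
  -- Open balls need radii exceeding the diameters; the excesses in the `n`-th powers form a
  -- geometric series with sum `ε / 2`.
  have hrex : ∀ i, ∃ r, D i < r ∧ r ≤ ε ∧ r ^ n ≤ D i ^ n + ε / 2 / 2 / 2 ^ i := by
    intro i
    have hc : Tendsto (fun r : ℝ => r ^ n) (𝓝[>] D i) (𝓝 (D i ^ n)) :=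
      ((continuous_pow n).tendsto (D i)).mono_left nhdsWithin_le_nhds
    have hlt : D i ^ n < D i ^ n + ε / 2 / 2 / 2 ^ i := lt_add_of_pos_right _ (by positivity)
    have hev : ∀ᶠ r in 𝓝[>] D i, r ≤ ε :=
      nhdsWithin_le_nhds (Iic_mem_nhds (by linarith [hDle i]))
    obtain ⟨r, hr1, hr2, hr3⟩ := ((hc.eventually_lt_const hlt).and
      (hev.and self_mem_nhdsWithin)).exists
    exact ⟨r, hr3, hr2, hr1.le⟩
  choose r hDr hrε hrn using hrex
  have hxex : ∀ i, ∃ x ∈ S, (t i ∩ S).Nonempty → x ∈ t i := by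
    intro i
    by_cases hne : (t i ∩ S).Nonempty
    · obtain ⟨x, hx, hxS⟩ := hne
      exact ⟨x, hxS, fun _ => hx⟩
    · exact ⟨s₀, hs₀, fun h => absurd h hne⟩
  choose x hxS hxt using hxex
  have hcover : S ⊆ ⋃ i, Metric.ball (x i) (r i) := by
    intro y hy
    obtain ⟨i, hi⟩ := Set.mem_iUnion.1 (hSt hy)
    refine Set.mem_iUnion.2 ⟨i, ?_⟩
    rw [Metric.mem_ball, dist_edist]
    exact lt_of_le_of_lt (ENNReal.toReal_mono (hfin i)
      (Metric.edist_le_ediam_of_mem hi (hxt i ⟨y, hi, hy⟩))) (hDr i)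
  obtain ⟨F, hF⟩ := hS.elim_finite_subcover _ (fun i => Metric.isOpen_ball) hcover
  refine ⟨F, x, r, fun i => ⟨ENNReal.toReal_nonneg.trans_lt (hDr i), hrε i⟩, fun i _ => hxS i, hF, ?_⟩
  have hsumD : ∑ i ∈ F, D i ^ n ≤ ε / 2 := by
    rw [← ENNReal.ofReal_le_ofReal_iff (by positivity),
      ENNReal.ofReal_sum_of_nonneg fun i _ => pow_nonneg ENNReal.toReal_nonneg n]
    refine le_trans ?_ (le_trans (ENNReal.sum_le_tsum F) htsum.le)
    refine Finset.sum_le_sum fun i _ => ?_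
    rw [ENNReal.ofReal_pow ENNReal.toReal_nonneg, ENNReal.ofReal_toReal (hfin i)]
    rcases (t i).eq_empty_or_nonempty with he | hne
    · simp [he, hn]
    · rw [iSup_pos hne, ENNReal.rpow_natCast]
  have hgeo : ∑ i ∈ F, ε / 2 / 2 / 2 ^ i ≤ ε / 2 :=
    sum_le_hasSum F (fun i _ => by positivity) (hasSum_geometric_two' (ε / 2))
  calc ∑ i ∈ F, r i ^ n ≤ ∑ i ∈ F, (D i ^ n + ε / 2 / 2 / 2 ^ i) := Finset.sum_le_sum fun i _ => hrn i
    _ ≤ ε := by rw [Finset.sum_add_distrib]; linarith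

/-- Cutoff functions that vanish near a compact null set of codimension one and have gradient small
in `L¹`. -/
theorem exists_cutoff {d : ℕ} (hd : 1 ≤ d) {S : Set (EuclideanSpace ℝ (Fin d))} (hS : IsCompact S)
    (h0 : μHE[d - 1] S = 0) : ∃ C : ℝ, 0 ≤ C ∧ ∀ ε : ℝ, 0 < ε →
      ∃ χ : EuclideanSpace ℝ (Fin d) → ℝ, ContDiff ℝ 1 χ ∧ (∀ x, |χ x| ≤ 1) ∧
        Disjoint (tsupport χ) S ∧ (∀ x, (∀ s ∈ S, 2 * ε < dist x s) → χ x = 1) ∧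
        Integrable (fderiv ℝ χ) ∧ ∫ x, ‖fderiv ℝ χ x‖ ≤ C * ε := by
  let V := EuclideanSpace ℝ (Fin d)
  let θ : ContDiffBump (0 : V) := ⟨1, 2, one_pos, one_lt_two⟩
  have hθ : ContDiff ℝ 1 θ := θ.contDiff
  obtain ⟨A, hA⟩ := (hθ.continuous_fderiv one_ne_zero).bounded_above_of_compact_support
    (θ.hasCompactSupport.fderiv ℝ)
  have hA0 : 0 ≤ A := (norm_nonneg _).trans (hA 0)
  set b : ℝ := (volume : Measure V).real (Metric.ball 0 1)
  have hb : 0 ≤ b := measureReal_nonneg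
  -- A ball of radius `r` contributes at most `A / r` on a ball of radius `2r` and volume `2^d b
  -- r^d`, that is `A 2^d b r^(d-1)`.
  refine ⟨A * 2 ^ d * b, by positivity, fun ε hε => ?_⟩
  obtain ⟨F, x, r, hr, hxS, hcov, hsum⟩ := exists_finset_ball_cover hS h0 hε
  -- Each factor is 0 on the ball, 1 beyond twice its radius. In the derivative of the product the
  -- remaining factors are at most 1 in absolute value, so the gradient bounds simply add.
  set k : ℕ → V → ℝ := fun i y => 1 - θ ((r i)⁻¹ • (y - x i)) with hk
  have hkd : ∀ i, ContDiff ℝ 1 (k i) := fun i =>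
    contDiff_const.sub (hθ.comp (by fun_prop))
  have hk1 : ∀ i y, |k i y| ≤ 1 := fun i y => by
    rw [abs_le]
    constructor <;> simp only [hk] <;> linarith [θ.le_one (x := (r i)⁻¹ • (y - x i)),
      θ.nonneg (x := (r i)⁻¹ • (y - x i))]
  have hscale : ∀ i y, ‖(r i)⁻¹ • (y - x i)‖ = dist y (x i) / r i := fun i y => by
    rw [norm_smul, norm_inv, Real.norm_of_nonneg (hr i).1.le, dist_eq_norm, inv_mul_eq_div]
  have hk_one : ∀ i y, 2 * r i < dist y (x i) → k i y = 1 := fun i y hy => by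
    have : θ ((r i)⁻¹ • (y - x i)) = 0 := θ.zero_of_le_dist (by
      rw [dist_zero_right, hscale, le_div_iff₀ (hr i).1]
      exact hy.le)
    simp only [hk, this, sub_zero]
  have hk_zero : ∀ i, ∀ y ∈ Metric.ball (x i) (r i), k i y = 0 := fun i y hy => by
    have : θ ((r i)⁻¹ • (y - x i)) = 1 := θ.one_of_mem_closedBall (by
      rw [mem_closedBall_zero_iff, hscale, div_le_iff₀ (hr i).1]
      exact (one_mul (r i)).symm ▸ (Metric.mem_ball.1 hy).le)
    simp only [hk, this, sub_self]
  have hkf : ∀ i y, ‖fderiv ℝ (k i) y‖ ≤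
      (Metric.closedBall (x i) (2 * r i)).indicator (fun _ => A * (r i)⁻¹) y := by
    intro i y
    by_cases hy : y ∈ Metric.closedBall (x i) (2 * r i)
    · rw [Set.indicator_of_mem hy]
      have h1 : HasFDerivAt (fun y : V => (r i)⁻¹ • (y - x i))
          ((r i)⁻¹ • ContinuousLinearMap.id ℝ V) y :=
        ((hasFDerivAt_id y).sub_const (x i)).const_smul (r i)⁻¹
      have h2 := ((hθ.differentiable one_ne_zero _).hasFDerivAt.comp y h1).const_sub 1
      have h3 : fderiv ℝ (k i) y = _ := h2.fderiv
      rw [h3, norm_neg]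
      refine (ContinuousLinearMap.opNorm_comp_le _ _).trans ?_
      refine mul_le_mul (hA _) ?_ (norm_nonneg _) hA0
      rw [norm_smul, norm_inv, Real.norm_of_nonneg (hr i).1.le]
      exact mul_le_of_le_one_right (inv_nonneg.2 (hr i).1.le) ContinuousLinearMap.norm_id_le
    · rw [Set.indicator_of_notMem hy]
      have h1 : k i =ᶠ[𝓝 y] fun _ => 1 := by
        filter_upwards [Metric.isClosed_closedBall.isOpen_compl.mem_nhds hy] with z hz
        exact hk_one i z (not_le.1 hz)
      rw [h1.fderiv_eq]
      simp
  set χ : V → ℝ := fun y => ∏ i ∈ F, k i y with hχ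
  have hχd : ContDiff ℝ 1 χ := contDiff_prod fun i _ => hkd i
  have hχf : ∀ y, ‖fderiv ℝ χ y‖ ≤
      ∑ i ∈ F, (Metric.closedBall (x i) (2 * r i)).indicator (fun _ => A * (r i)⁻¹) y := by
    intro y
    have h1 := HasFDerivAt.finsetProd (u := F) (g := k) (x := y)
      fun i _ => ((hkd i).differentiable one_ne_zero y).hasFDerivAt
    have h2 : fderiv ℝ χ y = _ := h1.fderiv
    rw [h2]
    refine (norm_sum_le _ _).trans (Finset.sum_le_sum fun i _ => ?_)
    rw [norm_smul]
    refine le_trans (mul_le_of_le_one_left (norm_nonneg _) ?_) (hkf i y)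
    rw [Real.norm_eq_abs, Finset.abs_prod]
    exact Finset.prod_le_one (fun j _ => abs_nonneg _) fun j _ => hk1 j y
  have hind : ∀ i ∈ F, Integrable
      ((Metric.closedBall (x i) (2 * r i)).indicator (fun _ : V => A * (r i)⁻¹)) := fun i _ =>
    (integrable_indicator_iff Metric.isClosed_closedBall.measurableSet).2
      (integrableOn_const (isCompact_closedBall _ _).measure_lt_top.ne)
  have hdom := integrable_finsetSum F hind
  refine ⟨χ, hχd, fun y => ?_, ?_, fun y hy => ?_, ?_, ?_⟩
  · rw [hχ, Finset.abs_prod]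
    exact Finset.prod_le_one (fun j _ => abs_nonneg _) fun j _ => hk1 j y
  · refine Set.disjoint_right.2 fun s hs => notMem_tsupport_iff_eventuallyEq.2 ?_
    obtain ⟨i, hi, hsi⟩ := Set.mem_iUnion₂.1 (hcov hs)
    filter_upwards [Metric.isOpen_ball.mem_nhds hsi] with y hy
    exact Finset.prod_eq_zero hi (hk_zero i y hy)
  · refine Finset.prod_eq_one fun i hi => hk_one i y ?_
    exact lt_of_le_of_lt (mul_le_mul_of_nonneg_left (hr i).2 zero_le_two) (hy _ (hxS i hi))
  · exact hdom.mono' (hχd.continuous_fderiv one_ne_zero).aestronglyMeasurable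
      (Eventually.of_forall hχf)
  · have hone : ∀ i ∈ F, ∫ y, (Metric.closedBall (x i) (2 * r i)).indicator
        (fun _ : V => A * (r i)⁻¹) y = A * 2 ^ d * b * r i ^ (d - 1) := by
      intro i _
      rw [integral_indicator Metric.isClosed_closedBall.measurableSet, setIntegral_const,
        Measure.addHaar_real_closedBall _ _ (by linarith [(hr i).1]), finrank_euclideanSpace_fin,
        smul_eq_mul, mul_pow]
      have h1 : r i ^ d = r i ^ (d - 1) * r i := by
        rw [← pow_succ, Nat.sub_add_cancel hd]
      have h2 := (hr i).1.ne'
      rw [h1]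
      field_simp
      exact mul_comm _ _
    calc ∫ y, ‖fderiv ℝ χ y‖ ≤ ∫ y, ∑ i ∈ F,
          (Metric.closedBall (x i) (2 * r i)).indicator (fun _ => A * (r i)⁻¹) y :=
          integral_mono_of_nonneg (Eventually.of_forall fun y => norm_nonneg _) hdom
            (Eventually.of_forall hχf)
      _ = A * 2 ^ d * b * ∑ i ∈ F, r i ^ (d - 1) := by
          rw [integral_finsetSum F hind, Finset.sum_congr rfl hone, Finset.mul_sum]
      _ ≤ _ := by gcongr

end Removal

/-! ### The divergence theorem -/

section DivergenceTheorem

variable {d : ℕ} {Ω : Set (EuclideanSpace ℝ (Fin d))} {h : EuclideanSpace ℝ (Fin d) → ℂ}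

/-- Apply the regular case to `χ_m h`, with `χ_m` vanishing near the singular set `S`. The extra
term `h ∂_v χ_m` is bounded in `L¹` by a multiple of `1/(m + 1)`. In the other terms `χ_m → 1` off
`S`, which is disjoint from `Ω` and null on the frontier, so dominated convergence applies. -/
theorem divergenceDefect_eq_zero (hd : 1 ≤ d) (hΩ : IsPiecewiseC1Region Ω) (hh : ContDiff ℝ 1 h)
    (hc : HasCompactSupport h) (v : EuclideanSpace ℝ (Fin d)) : divergenceDefect Ω h v = 0 := by
  set S := frontier Ω \ regularBoundary Ω
  have hSc : IsClosed S := isClosed_frontier_diff_regularBoundary hΩ.isOpen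
  obtain ⟨C, hC, hcut⟩ := exists_cutoff hd
    (hΩ.isCompact_frontier.of_isClosed_subset hSc Set.sdiff_subset) hΩ.area_singular
  have hεpos : ∀ m : ℕ, (0 : ℝ) < 1 / (m + 1) := fun m => by positivity
  choose χ hχd hχ1 hχS hχone hχi hχs using fun m : ℕ => hcut (1 / (m + 1)) (hεpos m)
  have hεlim : Tendsto (fun m : ℕ => (1 : ℝ) / (m + 1)) atTop (𝓝 0) :=
    tendsto_one_div_add_atTop_nhds_zero_nat
  have hχlim : ∀ x, x ∉ S → ∀ᶠ m in atTop, χ m x = 1 := by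
    intro x hx
    obtain ⟨δ, hδ, hball⟩ := Metric.isOpen_iff.1 hSc.isOpen_compl x hx
    filter_upwards [hεlim.eventually_lt_const (half_pos hδ)] with m hm
    refine hχone m x fun s hs => ?_
    have : δ ≤ dist x s := by
      by_contra hlt
      exact hball (by rw [Metric.mem_ball, dist_comm]; exact not_le.1 hlt) hs
    linarith
  have hχlim' : ∀ (u : EuclideanSpace ℝ (Fin d) → ℂ) x, x ∉ S →
      Tendsto (fun m => ((χ m x : ℝ) : ℂ) * u x) atTop (𝓝 (u x)) := by
    intro u x hx
    refine tendsto_const_nhds.congr' ?_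
    filter_upwards [hχlim x hx] with m hm
    rw [hm, Complex.ofReal_one, one_mul]
  have hχn : ∀ m x (z : ℂ), ‖((χ m x : ℝ) : ℂ) * z‖ ≤ ‖z‖ := fun m x z => by
    rw [norm_mul, Complex.norm_real]
    exact mul_le_of_le_one_left (norm_nonneg _) (hχ1 m x)
  set n := outwardNormal Ω
  have hofReal : ∀ m, ContDiff ℝ 1 fun x => ((χ m x : ℝ) : ℂ) := fun m =>
    Complex.ofRealCLM.contDiff.comp (hχd m)
  have hfd : ∀ m x, fderiv ℝ (fun x => ((χ m x : ℝ) : ℂ) * h x) x v =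
      ((χ m x : ℝ) : ℂ) * fderiv ℝ h x v + ((fderiv ℝ (χ m) x v : ℝ) : ℂ) * h x := by
    intro m x
    have h1 : HasFDerivAt (fun x => ((χ m x : ℝ) : ℂ))
        (Complex.ofRealCLM.comp (fderiv ℝ (χ m) x)) x :=
      Complex.ofRealCLM.hasFDerivAt.comp x ((hχd m).differentiable one_ne_zero x).hasFDerivAt
    have h2 := h1.mul (hh.differentiable one_ne_zero x).hasFDerivAt
    have h3 : fderiv ℝ (fun x => ((χ m x : ℝ) : ℂ) * h x) x = _ := h2.fderiv
    rw [h3]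
    simp
    ring
  have hI1 : ∀ m, Integrable (fun x => ((χ m x : ℝ) : ℂ) * fderiv ℝ h x v) := fun m =>
    (integrable_fderiv_apply hh hc v).mono
      ((hofReal m).continuous.aestronglyMeasurable.mul
        (integrable_fderiv_apply hh hc v).aestronglyMeasurable)
      (Eventually.of_forall fun x => hχn m x _)
  obtain ⟨A, hA⟩ := hh.continuous.bounded_above_of_compact_support hc
  have hA0 : 0 ≤ A := (norm_nonneg _).trans (hA 0)
  have hbd : ∀ m x, ‖((fderiv ℝ (χ m) x v : ℝ) : ℂ) * h x‖ ≤ (‖v‖ * A) * ‖fderiv ℝ (χ m) x‖ := by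
    intro m x
    rw [norm_mul, Complex.norm_real]
    calc _ ≤ (‖fderiv ℝ (χ m) x‖ * ‖v‖) * A :=
          mul_le_mul (ContinuousLinearMap.le_opNorm _ _) (hA x) (norm_nonneg _) (by positivity)
      _ = _ := by ring
  have hI2 : ∀ m, Integrable (fun x => ((fderiv ℝ (χ m) x v : ℝ) : ℂ) * h x) := fun m => by
    refine ((hχi m).norm.const_mul (‖v‖ * A)).mono' ?_ (Eventually.of_forall fun x => hbd m x)
    exact ((Complex.continuous_ofReal.comp
      (((hχd m).continuous_fderiv one_ne_zero).clm_apply continuous_const)).mul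
        hh.continuous).aestronglyMeasurable
  have hzero : ∀ m, (∫ x in Ω, ((χ m x : ℝ) : ℂ) * fderiv ℝ h x v) +
      (∫ x in Ω, ((fderiv ℝ (χ m) x v : ℝ) : ℂ) * h x) -
      ∫ x in frontier Ω, ((χ m x : ℝ) : ℂ) * (((inner ℝ v (n x) : ℝ) : ℂ) * h x) ∂μHE[d - 1] = 0 := by
    intro m
    have hts : tsupport (fun x => ((χ m x : ℝ) : ℂ) * h x) ⊆ tsupport (χ m) := by
      refine closure_mono fun x hx => ?_
      rw [Function.mem_support] at hx ⊢
      intro h0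
      exact hx (by rw [h0, Complex.ofReal_zero, zero_mul])
    have h1 := divergenceDefect_eq_zero_of_disjoint hΩ ((hofReal m).mul hh) hc.mul_left
      ((hχS m).mono_left hts) v
    simp only [divergenceDefect, hfd] at h1
    rw [integral_add (hI1 m).integrableOn (hI2 m).integrableOn] at h1
    rw [← h1]
    congr 2
    funext x
    ring
  have hlim1 : Tendsto (fun m => ∫ x in Ω, ((χ m x : ℝ) : ℂ) * fderiv ℝ h x v) atTop
      (𝓝 (∫ x in Ω, fderiv ℝ h x v)) := by
    refine tendsto_integral_of_dominated_convergence (fun x => ‖fderiv ℝ h x v‖)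
      (fun m => (hI1 m).aestronglyMeasurable.restrict)
      (integrable_fderiv_apply hh hc v).norm.integrableOn
      (fun m => Eventually.of_forall fun x => hχn m x _)
      ((ae_restrict_iff' hΩ.isOpen.measurableSet).2 (Eventually.of_forall fun x hx => ?_))
    refine hχlim' (fun x => fderiv ℝ h x v) x fun hxS => ?_
    have := hxS.1
    rw [hΩ.isOpen.frontier_eq] at this
    exact this.2 hx
  have hlim2 : Tendsto (fun m => ∫ x in Ω, ((fderiv ℝ (χ m) x v : ℝ) : ℂ) * h x) atTop (𝓝 0) := by
    have h1 : Tendsto (fun m : ℕ => (‖v‖ * A) * (C * ((1 : ℝ) / (m + 1)))) atTop (𝓝 0) := by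
      simpa using (hεlim.const_mul C).const_mul (‖v‖ * A)
    refine squeeze_zero_norm (fun m => ?_) h1
    calc _ ≤ ∫ x in Ω, (‖v‖ * A) * ‖fderiv ℝ (χ m) x‖ :=
          norm_integral_le_of_norm_le ((hχi m).norm.const_mul _).integrableOn
            (Eventually.of_forall fun x => hbd m x)
      _ ≤ ∫ x, (‖v‖ * A) * ‖fderiv ℝ (χ m) x‖ :=
          setIntegral_le_integral ((hχi m).norm.const_mul _)
            (Eventually.of_forall fun x => by positivity)
      _ ≤ _ := by
          rw [integral_const_mul]
          exact mul_le_mul_of_nonneg_left (hχs m) (by positivity)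
  have hbint := hΩ.integrableOn_frontier_inner_mul hh.continuous.continuousOn v
  have hlim3 : Tendsto (fun m => ∫ x in frontier Ω,
      ((χ m x : ℝ) : ℂ) * (((inner ℝ v (n x) : ℝ) : ℂ) * h x) ∂μHE[d - 1]) atTop
      (𝓝 (∫ x in frontier Ω, ((inner ℝ v (n x) : ℝ) : ℂ) * h x ∂μHE[d - 1])) := by
    refine tendsto_integral_of_dominated_convergence
      (fun x => ‖((inner ℝ v (n x) : ℝ) : ℂ) * h x‖)
      (fun m => (hofReal m).continuous.aestronglyMeasurable.mul hbint.aestronglyMeasurable)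
      hbint.norm (fun m => Eventually.of_forall fun x => hχn m x _) ?_
    have hae : ∀ᵐ x ∂(μHE[d - 1].restrict (frontier Ω)), x ∉ S :=
      measure_eq_zero_iff_ae_notMem.1
        (le_antisymm ((Measure.restrict_apply_le _ _).trans hΩ.area_singular.le) bot_le)
    filter_upwards [hae] with x hx
    exact hχlim' (fun x => ((inner ℝ v (n x) : ℝ) : ℂ) * h x) x hx
  have hlim := (hlim1.add hlim2).sub hlim3
  simp only [hzero, add_zero] at hlim
  exact tendsto_nhds_unique hlim tendsto_const_nhds

/-- The divergence theorem in a region with piecewise `C¹` boundary, for a vector field that is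
`C¹` in a neighbourhood of the closure. -/
theorem integral_divergence_eq (hd : 1 ≤ d) (hΩ : IsPiecewiseC1Region Ω)
    {V : Set (EuclideanSpace ℝ (Fin d))} (hV : IsOpen V) (hΩV : closure Ω ⊆ V)
    {F : EuclideanSpace ℝ (Fin d) → Fin d → ℂ} (hF : ∀ i, ContDiffOn ℝ 1 (fun x => F x i) V) :
    ∫ x in Ω, divergence F x =
      ∫ x in frontier Ω, ∑ i, ((outwardNormal Ω x i : ℝ) : ℂ) * F x i ∂μHE[d - 1] := by
  -- A cutoff equal to 1 near the closure and 0 outside a compact `L ⊆ V` makes the field global and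
  -- compactly supported without changing either integral.
  obtain ⟨L, hL, hΩL, hLV⟩ := exists_compact_between hΩ.isBounded.isCompact_closure hV hΩV
  obtain ⟨χ, hχ1, hχ0, -⟩ := exists_contMDiffMap_one_nhds_of_subset_interior (n := 1)
    (modelWithCornersSelf ℝ (EuclideanSpace ℝ (Fin d))) isClosed_closure hΩL
  have hχd : ContDiff ℝ 1 χ := χ.contMDiff.contDiff
  set k : Fin d → EuclideanSpace ℝ (Fin d) → ℂ := fun i x => ((χ x : ℝ) : ℂ) * F x i with hk
  have hk1 : ∀ i, ContDiff ℝ 1 (k i) := by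
    intro i
    refine contDiff_iff_contDiffAt.2 fun x => ?_
    by_cases hx : x ∈ L
    · exact (Complex.ofRealCLM.contDiff.comp hχd).contDiffAt.mul
        ((hF i).contDiffAt (hV.mem_nhds (hLV hx)))
    · refine (contDiffAt_const (c := (0 : ℂ))).congr_of_eventuallyEq ?_
      filter_upwards [hL.isClosed.isOpen_compl.mem_nhds hx] with y hy
      simp only [hk, hχ0 y hy, Complex.ofReal_zero, zero_mul]
  have hkc : ∀ i, HasCompactSupport (k i) := fun i =>
    HasCompactSupport.intro hL fun x hx => by
      simp only [hk, hχ0 x hx, Complex.ofReal_zero, zero_mul]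
  have hkF : ∀ i, ∀ x ∈ closure Ω, k i =ᶠ[𝓝 x] fun x => F x i := by
    intro i x hx
    filter_upwards [eventually_nhdsSet_iff_forall.1 hχ1 x hx] with y hy
    simp only [hk, hy, Complex.ofReal_one, one_mul]
  have hdef : ∀ i, ∫ x in Ω, fderiv ℝ (k i) x (EuclideanSpace.single i 1) =
      ∫ x in frontier Ω, ((inner ℝ (EuclideanSpace.single i (1 : ℝ)) (outwardNormal Ω x) : ℝ) : ℂ) *
        k i x ∂μHE[d - 1] := fun i =>
    sub_eq_zero.1 (divergenceDefect_eq_zero hd hΩ (hk1 i) (hkc i) (EuclideanSpace.single i 1))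
  have h1 : ∫ x in Ω, divergence F x =
      ∑ i, ∫ x in Ω, fderiv ℝ (k i) x (EuclideanSpace.single i 1) := by
    rw [← integral_finsetSum _ fun i _ => (integrable_fderiv_apply (hk1 i) (hkc i) _).integrableOn]
    refine setIntegral_congr_fun hΩ.isOpen.measurableSet fun x hx => ?_
    simp only [divergence]
    exact Finset.sum_congr rfl fun i _ => by rw [(hkF i x (subset_closure hx)).fderiv_eq]
  rw [h1, Finset.sum_congr rfl fun i _ => hdef i, ← integral_finsetSum _ fun i _ =>
    hΩ.integrableOn_frontier_inner_mul (hk1 i).continuous.continuousOn _]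
  refine setIntegral_congr_fun isClosed_frontier.measurableSet fun x hx => ?_
  refine Finset.sum_congr rfl fun i _ => ?_
  rw [(hkF i x (frontier_subset_closure hx)).self_of_nhds]
  simp [EuclideanSpace.inner_single_left]

end DivergenceTheorem

/-! ### The Hankel transform -/

section Hankel

variable {d : ℕ} {ν : ℂ} {f g : EuclideanSpace ℝ (Fin d) → ℝ} {x : EuclideanSpace ℝ (Fin d)}

theorem gradient_apply_eq_fderiv (i : Fin d) :
    ∇ g x i = fderiv ℝ g x (EuclideanSpace.single i 1) := by
  rw [← inner_gradient_eq_fderiv, EuclideanSpace.inner_single_right]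
  simp

theorem contDiff_gradient (hg : ContDiff ℝ (⊤ : ℕ∞) g) : ContDiff ℝ (⊤ : ℕ∞) (∇ g) :=
  (InnerProductSpace.toDual ℝ (EuclideanSpace ℝ (Fin d))).symm.toContinuousLinearEquiv.contDiff.comp
    (hg.fderiv_right (by simp))

/-- The vector field `∇g / (|∇g|² g ^ μ)`. -/
noncomputable def hankelField (μ : ℂ) (g : EuclideanSpace ℝ (Fin d) → ℝ)
    (y : EuclideanSpace ℝ (Fin d)) (i : Fin d) : ℂ :=
  ((∇ g y i : ℝ) : ℂ) / (((‖∇ g y‖ ^ 2 : ℝ) : ℂ) * (g y : ℂ) ^ μ)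

theorem contDiffAt_ofReal_comp_cpow (hg : ContDiff ℝ (⊤ : ℕ∞) g) (hx : g x ≠ 0) (μ : ℂ) :
    ContDiffAt ℝ (⊤ : ℕ∞) (fun y => (g y : ℂ) ^ μ) x :=
  ContDiffAt.comp (g := fun s : ℝ => (s : ℂ) ^ μ) x (contDiffAt_ofReal_cpow μ hx) hg.contDiffAt

theorem ofReal_cpow_ne_zero (hx : g x ≠ 0) (μ : ℂ) : (g x : ℂ) ^ μ ≠ 0 := by
  rw [Complex.cpow_def_of_ne_zero (by exact_mod_cast hx)]
  exact Complex.exp_ne_zero _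

theorem contDiffAt_hankelField (hg : ContDiff ℝ (⊤ : ℕ∞) g) (hx : g x ≠ 0) (hx' : ∇ g x ≠ 0) (μ : ℂ)
    (i : Fin d) : ContDiffAt ℝ (⊤ : ℕ∞) (fun y => hankelField μ g y i) x := by
  have h1 : ContDiffAt ℝ (⊤ : ℕ∞) (fun y => ((∇ g y i : ℝ) : ℂ)) x :=
    Complex.ofRealCLM.contDiff.contDiffAt.comp x
      ((contDiff_euclidean.1 (contDiff_gradient hg) i).contDiffAt)
  have h2 : ContDiffAt ℝ (⊤ : ℕ∞) (fun y => ((‖∇ g y‖ ^ 2 : ℝ) : ℂ)) x :=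
    Complex.ofRealCLM.contDiff.contDiffAt.comp x ((contDiff_gradient hg).norm_sq ℝ).contDiffAt
  simp only [hankelField, div_eq_mul_inv]
  refine h1.mul ((h2.mul (contDiffAt_ofReal_comp_cpow hg hx μ)).inv ?_)
  refine mul_ne_zero ?_ (ofReal_cpow_ne_zero hx μ)
  exact_mod_cast pow_ne_zero 2 (norm_ne_zero_iff.2 hx')

theorem contDiffAt_divergence {F : EuclideanSpace ℝ (Fin d) → Fin d → ℂ}
    (hF : ∀ i, ContDiffAt ℝ (⊤ : ℕ∞) (fun y => F y i) x) :
    ContDiffAt ℝ (⊤ : ℕ∞) (divergence F) x :=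
  ContDiffAt.sum fun i _ => ((hF i).fderiv_right (by simp)).clm_apply contDiffAt_const

theorem contDiffAt_hankelSigma (hf : ContDiff ℝ (⊤ : ℕ∞) f) (hg : ContDiff ℝ (⊤ : ℕ∞) g)
    (hx : g x ≠ 0) (hx' : ∇ g x ≠ 0) (k : ℕ) :
    ContDiffAt ℝ (⊤ : ℕ∞) (hankelSigma ν f g k) x := by
  induction k with
  | zero => exact Complex.ofRealCLM.contDiff.contDiffAt.comp x hf.contDiffAt
  | succ k ih =>
    exact (contDiffAt_ofReal_comp_cpow hg hx _).mul
      (contDiffAt_divergence fun i => (contDiffAt_hankelField hg hx hx' _ i).mul ih)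

theorem contDiffAt_besselJ_comp (hg : ContDiff ℝ (⊤ : ℕ∞) g) (hx : g x ≠ 0) (μ : ℂ) {ω : ℝ}
    (hω : ω ≠ 0) : ContDiffAt ℝ (⊤ : ℕ∞) (fun y => besselJ μ ((ω * g y : ℝ) : ℂ)) x :=
  ContDiffAt.comp (g := fun s : ℝ => besselJ μ (s : ℂ)) (f := fun y => ω * g y) x
    (contDiffAt_besselJ_ofReal μ (mul_ne_zero hω hx)) (contDiffAt_const.mul hg.contDiffAt)

theorem divergence_mul {F : EuclideanSpace ℝ (Fin d) → Fin d → ℂ} {P : EuclideanSpace ℝ (Fin d) → ℂ}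
    (hF : ∀ i, DifferentiableAt ℝ (fun y => F y i) x) (hP : DifferentiableAt ℝ P x) :
    divergence (fun y i => F y i * P y) x =
      divergence F x * P x + ∑ i, F x i * fderiv ℝ P x (EuclideanSpace.single i 1) := by
  simp only [divergence, Finset.sum_mul, ← Finset.sum_add_distrib]
  refine Finset.sum_congr rfl fun i _ => ?_
  rw [fderiv_fun_mul (hF i) hP]
  simp
  ring

theorem sum_hankelField_mul_gradient (hx' : ∇ g x ≠ 0) (μ : ℂ) :
    ∑ i, hankelField μ g x i * ((∇ g x i : ℝ) : ℂ) = ((g x : ℂ) ^ μ)⁻¹ := by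
  have h1 : ∑ i, ((∇ g x i : ℝ) : ℂ) * ((∇ g x i : ℝ) : ℂ) = ((‖∇ g x‖ ^ 2 : ℝ) : ℂ) := by
    rw [EuclideanSpace.real_norm_sq_eq]
    push_cast
    exact Finset.sum_congr rfl fun i _ => by ring
  have h2 : ((‖∇ g x‖ ^ 2 : ℝ) : ℂ) ≠ 0 := by
    exact_mod_cast pow_ne_zero 2 (norm_ne_zero_iff.2 hx')
  simp only [hankelField, div_mul_eq_mul_div, ← Finset.sum_div, h1]
  rw [div_mul_eq_div_div, div_self h2, one_div]

/-- The vector field whose divergence yields the recursion for the Hankel transforms. -/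
noncomputable def hankelFlux (ν : ℂ) (f g : EuclideanSpace ℝ (Fin d) → ℝ) (k : ℕ) (ω : ℝ)
    (y : EuclideanSpace ℝ (Fin d)) (i : Fin d) : ℂ :=
  hankelField (ν + (k + 1 : ℕ)) g y i * hankelSigma ν f g k y *
    ((g y : ℂ) ^ (ν + (k + 1 : ℕ)) * besselJ (ν + (k + 1 : ℕ)) ((ω * g y : ℝ) : ℂ))

theorem contDiffAt_hankelFlux (hf : ContDiff ℝ (⊤ : ℕ∞) f) (hg : ContDiff ℝ (⊤ : ℕ∞) g)
    (hx : g x ≠ 0) (hx' : ∇ g x ≠ 0) (k : ℕ) {ω : ℝ} (hω : ω ≠ 0) (i : Fin d) :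
    ContDiffAt ℝ (⊤ : ℕ∞) (fun y => hankelFlux ν f g k ω y i) x :=
  ((contDiffAt_hankelField hg hx hx' _ i).mul (contDiffAt_hankelSigma hf hg hx hx' k)).mul
    ((contDiffAt_ofReal_comp_cpow hg hx _).mul (contDiffAt_besselJ_comp hg hx _ hω))

/-- Product rule: the divergence of `hankelField · σ_k` times `g^μ` is `σ_{k+1}` by definition. The
gradient of `g^μ J_μ(ωg)` is `ω g^μ J_{μ-1}(ωg) ∇g`, and the field paired with `∇g` gives `g^{-μ}`,
which cancels the power. -/
theorem divergence_hankelFlux (hf : ContDiff ℝ (⊤ : ℕ∞) f) (hg : ContDiff ℝ (⊤ : ℕ∞) g)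
    (hx : g x ≠ 0) (hx' : ∇ g x ≠ 0) (k : ℕ) {ω : ℝ} (hω : ω ≠ 0) :
    divergence (hankelFlux ν f g k ω) x =
      hankelSigma ν f g (k + 1) x * besselJ (ν + (k + 1 : ℕ)) ((ω * g x : ℝ) : ℂ) +
      ω * (hankelSigma ν f g k x * besselJ (ν + k) ((ω * g x : ℝ) : ℂ)) := by
  set μ : ℂ := ν + (k + 1 : ℕ) with hμ
  have htop : ((⊤ : ℕ∞) : WithTop ℕ∞) ≠ 0 := by simp
  have hF : ∀ i, DifferentiableAt ℝ (fun y => hankelField μ g y i * hankelSigma ν f g k y) x :=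
    fun i => ((contDiffAt_hankelField hg hx hx' _ i).mul
      (contDiffAt_hankelSigma hf hg hx hx' k)).differentiableAt htop
  have hP : HasFDerivAt (fun y => (g y : ℂ) ^ μ * besselJ μ ((ω * g y : ℝ) : ℂ))
      ((fderiv ℝ g x).smulRight (ω * ((g x : ℂ) ^ μ * besselJ (μ - 1) ((ω * g x : ℝ) : ℂ)))) x :=
    (hasDerivAt_cpow_mul_besselJ μ hω hx).hasFDerivAt.comp x
      (hg.differentiable htop x).hasFDerivAt
  have h1 : divergence (hankelFlux ν f g k ω) x = _ := divergence_mul hF hP.differentiableAt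
  have hμ1 : μ - 1 = ν + k := by rw [hμ]; push_cast; ring
  have hc := ofReal_cpow_ne_zero hx μ
  have h2 : ∑ i, hankelField μ g x i * hankelSigma ν f g k x *
      fderiv ℝ (fun y => (g y : ℂ) ^ μ * besselJ μ ((ω * g y : ℝ) : ℂ)) x
        (EuclideanSpace.single i 1) =
      ω * (hankelSigma ν f g k x * besselJ (ν + k) ((ω * g x : ℝ) : ℂ)) := by
    have h3 := sum_hankelField_mul_gradient hx' μ
    rw [hP.fderiv, hμ1]
    calc _ = ∑ i, (hankelField μ g x i * ((∇ g x i : ℝ) : ℂ)) * (hankelSigma ν f g k x *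
          (ω * ((g x : ℂ) ^ μ * besselJ (ν + k) ((ω * g x : ℝ) : ℂ)))) := by
          refine Finset.sum_congr rfl fun i _ => ?_
          rw [ContinuousLinearMap.smulRight_apply, ← gradient_apply_eq_fderiv, Complex.real_smul]
          ring
      _ = _ := by
          rw [← Finset.sum_mul, h3]
          field_simp
  have h4 : hankelSigma ν f g (k + 1) x = (g x : ℂ) ^ μ *
      divergence (fun y i => hankelField μ g y i * hankelSigma ν f g k y) x := rfl
  rw [h1, h2, h4]
  ring

theorem sum_outwardNormal_mul_hankelFlux (Ω : Set (EuclideanSpace ℝ (Fin d))) (hx : g x ≠ 0)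
    (k : ℕ) (ω : ℝ) :
    ∑ i, ((outwardNormal Ω x i : ℝ) : ℂ) * hankelFlux ν f g k ω x i =
      hankelBoundaryIntegrand ν f g Ω (k + 1) ω x := by
  have hc := ofReal_cpow_ne_zero hx (ν + (k + 1 : ℕ))
  have h1 : ((inner ℝ (∇ g x) (outwardNormal Ω x) / ‖∇ g x‖ ^ 2 : ℝ) : ℂ) =
      ∑ i, ((outwardNormal Ω x i : ℝ) : ℂ) * ((∇ g x i : ℝ) : ℂ) / ((‖∇ g x‖ ^ 2 : ℝ) : ℂ) := by
    rw [← Finset.sum_div, PiLp.inner_apply]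
    push_cast
    simp
  rw [hankelBoundaryIntegrand, h1, Nat.add_sub_cancel, Finset.sum_mul, Finset.sum_mul]
  refine Finset.sum_congr rfl fun i _ => ?_
  simp only [hankelFlux, hankelField]
  field_simp

end Hankel

/-! ### The recursion, the exact remainder and the size of the integrals -/

section Transform

variable {d : ℕ} {ν : ℂ} {f g : EuclideanSpace ℝ (Fin d) → ℝ}
  {Ω : Set (EuclideanSpace ℝ (Fin d))}

theorem IsPiecewiseC1Region.isCompact_closure (hΩ : IsPiecewiseC1Region Ω) :
    IsCompact (closure Ω) :=
  hΩ.isBounded.isCompact_closure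

theorem IsPiecewiseC1Region.volume_lt_top (hΩ : IsPiecewiseC1Region Ω) :
    (volume : Measure (EuclideanSpace ℝ (Fin d))) Ω < ⊤ :=
  (measure_mono subset_closure).trans_lt hΩ.isCompact_closure.measure_lt_top

theorem isOpen_hankelDomain (hg : ContDiff ℝ (⊤ : ℕ∞) g) : IsOpen {x | g x ≠ 0 ∧ ∇ g x ≠ 0} :=
  (isOpen_ne_fun hg.continuous continuous_const).inter
    (isOpen_ne_fun (contDiff_gradient hg).continuous continuous_const)

theorem continuousOn_hankelSigma (hf : ContDiff ℝ (⊤ : ℕ∞) f) (hg : ContDiff ℝ (⊤ : ℕ∞) g)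
    (hzero : ∀ x ∈ closure Ω, g x ≠ 0) (hstat : ∀ x ∈ closure Ω, ∇ g x ≠ 0) (k : ℕ) :
    ContinuousOn (hankelSigma ν f g k) (closure Ω) := fun x hx =>
  (contDiffAt_hankelSigma hf hg (hzero x hx) (hstat x hx) k).continuousAt.continuousWithinAt

theorem integrableOn_hankelSigma_mul_besselJ (hΩ : IsPiecewiseC1Region Ω)
    (hf : ContDiff ℝ (⊤ : ℕ∞) f) (hg : ContDiff ℝ (⊤ : ℕ∞) g)
    (hzero : ∀ x ∈ closure Ω, g x ≠ 0) (hstat : ∀ x ∈ closure Ω, ∇ g x ≠ 0) (k : ℕ) (μ : ℂ) {ω : ℝ}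
    (hω : 0 < ω) :
    IntegrableOn (fun x => hankelSigma ν f g k x * besselJ μ ((ω * g x : ℝ) : ℂ)) Ω := by
  refine IntegrableOn.mono_set (ContinuousOn.integrableOn_compact hΩ.isCompact_closure ?_)
    subset_closure
  exact (continuousOn_hankelSigma hf hg hzero hstat k).mul fun x hx =>
    (contDiffAt_besselJ_comp hg (hzero x hx) μ hω.ne').continuousAt.continuousWithinAt

theorem integrableOn_hankelBoundaryIntegrand (hΩ : IsPiecewiseC1Region Ω)
    (hf : ContDiff ℝ (⊤ : ℕ∞) f) (hg : ContDiff ℝ (⊤ : ℕ∞) g)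
    (hzero : ∀ x ∈ closure Ω, g x ≠ 0) (hstat : ∀ x ∈ closure Ω, ∇ g x ≠ 0) (k : ℕ) {ω : ℝ}
    (hω : 0 < ω) :
    IntegrableOn (hankelBoundaryIntegrand ν f g Ω (k + 1) ω) (frontier Ω) μHE[d - 1] := by
  have h1 : ∀ i, IntegrableOn (fun x => ((outwardNormal Ω x i : ℝ) : ℂ) * hankelFlux ν f g k ω x i)
      (frontier Ω) μHE[d - 1] := by
    intro i
    have h2 := hΩ.integrableOn_frontier_inner_mul (h := fun x => hankelFlux ν f g k ω x i)
      (fun x hx => (contDiffAt_hankelFlux hf hg (hzero x (frontier_subset_closure hx))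
        (hstat x (frontier_subset_closure hx)) k hω.ne' i).continuousAt.continuousWithinAt)
      (EuclideanSpace.single i 1)
    simpa [EuclideanSpace.inner_single_left] using h2
  refine IntegrableOn.congr_fun (integrable_finsetSum Finset.univ fun i _ => h1 i)
    (fun x hx => ?_) isClosed_frontier.measurableSet
  exact sum_outwardNormal_mul_hankelFlux Ω (hzero x (frontier_subset_closure hx)) k ω

/-- The recursion for the Hankel transforms. -/
theorem setIntegral_hankelBoundaryIntegrand (hd : 1 ≤ d) (hΩ : IsPiecewiseC1Region Ω)
    (hf : ContDiff ℝ (⊤ : ℕ∞) f) (hg : ContDiff ℝ (⊤ : ℕ∞) g)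
    (hzero : ∀ x ∈ closure Ω, g x ≠ 0) (hstat : ∀ x ∈ closure Ω, ∇ g x ≠ 0) (k : ℕ) {ω : ℝ}
    (hω : 0 < ω) :
    ∫ x in frontier Ω, hankelBoundaryIntegrand ν f g Ω (k + 1) ω x ∂μHE[d - 1] =
      (∫ x in Ω, hankelSigma ν f g (k + 1) x * besselJ (ν + (k + 1 : ℕ)) ((ω * g x : ℝ) : ℂ)) +
      ω * ∫ x in Ω, hankelSigma ν f g k x * besselJ (ν + k) ((ω * g x : ℝ) : ℂ) := by
  have hdiv := integral_divergence_eq hd hΩ (isOpen_hankelDomain hg)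
    (fun x hx => ⟨hzero x hx, hstat x hx⟩) (F := hankelFlux ν f g k ω) fun i x hx =>
      ((contDiffAt_hankelFlux hf hg hx.1 hx.2 k hω.ne' i).of_le
        (by exact_mod_cast le_top)).contDiffWithinAt
  rw [setIntegral_congr_fun isClosed_frontier.measurableSet fun x hx =>
    sum_outwardNormal_mul_hankelFlux Ω (hzero x (frontier_subset_closure hx)) k ω,
    setIntegral_congr_fun hΩ.isOpen.measurableSet fun x hx =>
      divergence_hankelFlux hf hg (hzero x (subset_closure hx)) (hstat x (subset_closure hx)) k
        hω.ne'] at hdiv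
  rw [← hdiv, ← integral_const_mul, ← integral_add
    (integrableOn_hankelSigma_mul_besselJ hΩ hf hg hzero hstat (k + 1) _ hω)
    ((integrableOn_hankelSigma_mul_besselJ hΩ hf hg hzero hstat k _ hω).const_mul _)]

/-- Solving the recursion for the integral with `σ_k` trades it for a boundary term and `-1/ω` times
the next one; this is iterated exactly, for each fixed `ω`. -/
theorem hankelTransform_eq_sum_add (hd : 1 ≤ d) (hΩ : IsPiecewiseC1Region Ω)
    (hf : ContDiff ℝ (⊤ : ℕ∞) f) (hg : ContDiff ℝ (⊤ : ℕ∞) g)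
    (hzero : ∀ x ∈ closure Ω, g x ≠ 0) (hstat : ∀ x ∈ closure Ω, ∇ g x ≠ 0) (s : ℕ) {ω : ℝ}
    (hω : 0 < ω) :
    (∫ x in Ω, hankelIntegrand ν f g ω x) - (-∑ k ∈ Finset.Icc 1 s, 1 / (-(ω : ℂ)) ^ k *
      ∫ x in frontier Ω, hankelBoundaryIntegrand ν f g Ω k ω x ∂μHE[d - 1]) =
    1 / (-(ω : ℂ)) ^ s *
      ∫ x in Ω, hankelSigma ν f g s x * besselJ (ν + s) ((ω * g x : ℝ) : ℂ) := by
  have hωC : (ω : ℂ) ≠ 0 := by exact_mod_cast hω.ne'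
  induction s with
  | zero => simp [hankelIntegrand, hankelSigma]
  | succ s ih =>
    rw [Finset.sum_Icc_succ_top (by omega), setIntegral_hankelBoundaryIntegrand hd hΩ hf hg hzero
      hstat s hω]
    rw [sub_neg_eq_add] at ih ⊢
    rw [← add_assoc, ih, pow_succ]
    field_simp
    ring

/-- By compactness `|g|` has a positive minimum `c` on the closure; once `ω c ≥ 1` the decay
estimate holds uniformly there. -/
theorem exists_norm_besselJ_comp_le (hΩ : IsPiecewiseC1Region Ω) (hg : ContDiff ℝ (⊤ : ℕ∞) g)
    (hzero : ∀ x ∈ closure Ω, g x ≠ 0) (μ : ℂ) :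
    ∃ C : ℝ, 0 ≤ C ∧ ∀ᶠ ω : ℝ in atTop, ∀ x ∈ closure Ω,
      ‖besselJ μ ((ω * g x : ℝ) : ℂ)‖ ≤ C * ω ^ (-(1 / 2) : ℝ) := by
  obtain ⟨C, hC, hJ⟩ := exists_norm_besselJ_le μ
  obtain ⟨x₀, hx₀, hmin⟩ := hΩ.isCompact_closure.exists_isMinOn hΩ.isConnected.nonempty.closure
    hg.continuous.abs.continuousOn
  set c := |g x₀|
  have hc : 0 < c := abs_pos.2 (hzero x₀ hx₀)
  refine ⟨C * c ^ (-(1 / 2) : ℝ), by positivity, ?_⟩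
  filter_upwards [eventually_ge_atTop (1 / c), eventually_gt_atTop 0] with ω hω hω0 x hx
  have hcx : c ≤ |g x| := hmin hx
  have h1 : |ω * g x| = ω * |g x| := by rw [abs_mul, abs_of_pos hω0]
  have h2 : ω * c ≤ |ω * g x| := by rw [h1]; gcongr
  have h3 : 1 ≤ ω * c := (div_le_iff₀ hc).1 hω
  refine (hJ _ (h3.trans h2)).trans ?_
  rw [mul_assoc, ← Real.mul_rpow hc.le hω0.le, mul_comm c ω]
  exact mul_le_mul_of_nonneg_left
    (Real.rpow_le_rpow_of_nonpos (mul_pos hω0 hc) h2 (by norm_num)) hC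

theorem isBigO_hankelSigma_integral (hΩ : IsPiecewiseC1Region Ω)
    (hf : ContDiff ℝ (⊤ : ℕ∞) f) (hg : ContDiff ℝ (⊤ : ℕ∞) g)
    (hzero : ∀ x ∈ closure Ω, g x ≠ 0) (hstat : ∀ x ∈ closure Ω, ∇ g x ≠ 0) (k : ℕ) (μ : ℂ) :
    (fun ω : ℝ => ∫ x in Ω, hankelSigma ν f g k x * besselJ μ ((ω * g x : ℝ) : ℂ))
      =O[atTop] fun ω : ℝ => ω ^ (-(1 / 2) : ℝ) := by
  obtain ⟨A, hA⟩ := hΩ.isCompact_closure.exists_bound_of_continuousOn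
    (continuousOn_hankelSigma (ν := ν) hf hg hzero hstat k)
  obtain ⟨C, hC, hJ⟩ := exists_norm_besselJ_comp_le hΩ hg hzero μ
  refine IsBigO.of_bound (A * C * volume.real Ω) ?_
  filter_upwards [hJ, eventually_gt_atTop 0] with ω hω hω0
  rw [Real.norm_of_nonneg (Real.rpow_nonneg hω0.le _)]
  refine (norm_setIntegral_le_of_norm_le_const hΩ.volume_lt_top
    (C := A * (C * ω ^ (-(1 / 2) : ℝ))) fun x hx => ?_).trans (le_of_eq (by ring))
  have hx' := subset_closure hx
  rw [norm_mul]
  exact mul_le_mul (hA x hx') (hω x hx') (norm_nonneg _) ((norm_nonneg _).trans (hA x hx'))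

theorem isBigO_hankelBoundaryIntegral (hΩ : IsPiecewiseC1Region Ω)
    (hf : ContDiff ℝ (⊤ : ℕ∞) f) (hg : ContDiff ℝ (⊤ : ℕ∞) g)
    (hzero : ∀ x ∈ closure Ω, g x ≠ 0) (hstat : ∀ x ∈ closure Ω, ∇ g x ≠ 0) (k : ℕ) :
    (fun ω : ℝ => ∫ x in frontier Ω, hankelBoundaryIntegrand ν f g Ω k ω x ∂μHE[d - 1])
      =O[atTop] fun ω : ℝ => ω ^ (-(1 / 2) : ℝ) := by
  have hcont : ContinuousOn (fun x => ((‖∇ g x‖⁻¹ : ℝ) : ℂ) * hankelSigma ν f g (k - 1) x)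
      (closure Ω) := by
    refine ContinuousOn.mul ?_ (continuousOn_hankelSigma hf hg hzero hstat (k - 1))
    exact Complex.continuous_ofReal.comp_continuousOn
      ((contDiff_gradient hg).continuous.norm.continuousOn.inv₀ fun x hx =>
        norm_ne_zero_iff.2 (hstat x hx))
  obtain ⟨A, hA⟩ := hΩ.isCompact_closure.exists_bound_of_continuousOn hcont
  obtain ⟨C, hC, hJ⟩ := exists_norm_besselJ_comp_le hΩ hg hzero (ν + k)
  refine IsBigO.of_bound (A * C * (μHE[d - 1] : Measure _).real (frontier Ω)) ?_
  filter_upwards [hJ, eventually_gt_atTop 0] with ω hω hω0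
  rw [Real.norm_of_nonneg (Real.rpow_nonneg hω0.le _)]
  refine (norm_setIntegral_le_of_norm_le_const hΩ.area_lt_top
    (C := A * (C * ω ^ (-(1 / 2) : ℝ))) fun x hx => ?_).trans (le_of_eq (by ring))
  have hx' := frontier_subset_closure hx
  rw [hankelBoundaryIntegrand, norm_mul]
  refine mul_le_mul (le_trans ?_ (hA x hx')) (hω x hx') (norm_nonneg _)
    ((norm_nonneg _).trans (hA x hx'))
  have hpos : 0 < ‖∇ g x‖ := norm_pos_iff.2 (hstat x hx')
  rw [norm_mul, norm_mul, Complex.norm_real, Complex.norm_real]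
  refine mul_le_mul_of_nonneg_right ?_ (norm_nonneg _)
  rw [norm_div, norm_pow, norm_norm, norm_inv, norm_norm, div_le_iff₀ (by positivity)]
  calc ‖inner ℝ (∇ g x) (outwardNormal Ω x)‖ ≤ ‖∇ g x‖ * ‖outwardNormal Ω x‖ := norm_inner_le_norm _ _
    _ ≤ ‖∇ g x‖ := mul_le_of_le_one_right hpos.le (norm_outwardNormal_le _ _)
    _ = ‖∇ g x‖⁻¹ * ‖∇ g x‖ ^ 2 := by field_simp

end Transform

theorem mainTheorem11 {d : ℕ} (hd : 1 ≤ d) (ν : ℂ)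
    (Ω : Set (EuclideanSpace ℝ (Fin d))) (hΩ : IsPiecewiseC1Region Ω)
    (f g : EuclideanSpace ℝ (Fin d) → ℝ) (hf : ContDiff ℝ (⊤ : ℕ∞) f) (hg : ContDiff ℝ (⊤ : ℕ∞) g)
    (hzero : ∀ x ∈ closure Ω, g x ≠ 0)
    (hstat : ∀ x ∈ closure Ω, ∇ g x ≠ 0) :
    (∀ ω : ℝ, 0 < ω → IntegrableOn (hankelIntegrand ν f g ω) Ω volume) ∧
    (∀ ω : ℝ, 0 < ω → ∀ k : ℕ, 1 ≤ k →
      IntegrableOn (hankelBoundaryIntegrand ν f g Ω k ω) (frontier Ω) μHE[d - 1]) ∧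
    ∀ s : ℕ,
      (fun ω : ℝ => (∫ x in Ω, hankelIntegrand ν f g ω x) -
        (-∑ k ∈ Finset.Icc 1 s, 1 / (-(ω : ℂ)) ^ k *
          ∫ x in frontier Ω, hankelBoundaryIntegrand ν f g Ω k ω x ∂μHE[d - 1]))
        =O[atTop] (fun ω : ℝ => ω ^ (-(s : ℝ) - 3 / 2)) := by
  refine ⟨fun ω hω => 
    integrableOn_hankelSigma_mul_besselJ (ν := ν) hΩ hf hg hzero hstat 0 ν hω,
    fun ω hω k hk => ?_, fun s => ?_⟩
  · obtain ⟨j, rfl⟩ := Nat.exists_eq_add_of_le' hk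
    exact integrableOn_hankelBoundaryIntegrand hΩ hf hg hzero hstat j hω
  · have hrem := (isBigO_hankelBoundaryIntegral (ν := ν) hΩ hf hg hzero hstat (s + 1)).sub
      (isBigO_hankelSigma_integral (ν := ν) hΩ hf hg hzero hstat (s + 1) (ν + (s + 1 : ℕ)))
    have hpow : (fun ω : ℝ => 1 / ((-(ω : ℂ)) ^ s * ω)) =O[atTop]
        fun ω : ℝ => ω ^ (-(s : ℝ) - 1) := by
      refine IsBigO.of_bound 1 ?_
      filter_upwards [eventually_gt_atTop 0] with ω hω
      rw [one_mul, Real.norm_of_nonneg (Real.rpow_nonneg hω.le _), norm_div, norm_one, norm_mul,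
        norm_pow, norm_neg, Complex.norm_real, Real.norm_of_nonneg hω.le, ← pow_succ, one_div,
        ← Real.rpow_natCast, ← Real.rpow_neg hω.le]
      push_cast
      rw [neg_add, ← sub_eq_add_neg]
    refine (hpow.mul hrem).congr' ?_ ?_
    · filter_upwards [eventually_gt_atTop 0] with ω hω
      have hωC : (ω : ℂ) ≠ 0 := by exact_mod_cast hω.ne'
      rw [hankelTransform_eq_sum_add hd hΩ hf hg hzero hstat s hω,
        setIntegral_hankelBoundaryIntegrand hd hΩ hf hg hzero hstat s hω, add_sub_cancel_left]
      field_simp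
    · filter_upwards [eventually_gt_atTop 0] with ω hω
      rw [← Real.rpow_add hω]
      congr 1
      ring
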